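/- **Setting.** Fix $d$ variable indices. The $i$-th variable takes values in a standard Borel space $\mathcal X_i$ with a $\sigma$-finite reference measure $\mu_i$ (e.g. Lebesgue or counting measure), with respect to which all densities are taken. An *ICM generative process* consists of a DAG $\mathcal G$ on $[d]$, parameter spaces $\Theta_i$ with independent priors $\nu_i$ (probability measures), and measurable conditional densities $p_i(x_i\mid \mathrm{pa}_i,\theta_i)$, with $\mathrm{pa}_i$ a value of the parents of $i$ in $\mathcal G$. It generates the law $P$ of an infinite exchangeable sequence of arrays $(X_{1;n},\dots,X_{d;n})_{n\in\mathbb N}$ given, for every $N$, by $$p(\mathbf x_{:;[N]})=\int\!\cdots\!\int \prod_{n=1}^N\prod_{i=1}^d p_i(x_{i;n}\mid \mathrm{pa}_{i;n},\theta_i)\,d\nu_1(\theta_1)\cdots d\nu_d(\theta_d).$$ For a set $\mathbf X$ of observables $X_{i;n}$ and a value $\mathbf x$ of $\mathbf X$, the law $P(\,\cdot\mid do(\mathbf X=\mathbf x))$ is obtained by replacing, for every $X_{i;n}\in\mathbf X$, the factor $p_i(\cdot\mid \mathrm{pa}_{i;n},\theta_i)$ by the point mass at the value that $\mathbf x$ assigns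 to $X_{i;n}$, and substituting $\mathbf X=\mathbf x$ in the remaining factors; $P(\mathbf Y\mid do(\mathbf X=\mathbf x))$ is its marginal on $\mathbf Y$. The mixed graph $\mathrm{ICM}(\mathcal G)$ on the vertices $X_{i;n}$ has the edges $X_{i;n}\to X_{j;n}$ for $i\to j$ in $\mathcal G$ and all $n$, the edges $X_{i;n}\leftrightarrow X_{i;m}$ for all $i$ and $n\ne m$, and no others. $P$ is *faithful* to it if, for all disjoint finite sets $A,B,C$ of observables, $A\perp\!\!\!\perp B\mid C$ under $P$ implies that $C$ separates $A$ from $B$ in $\mathrm{ICM}(\mathcal G)$ (m-separation). **Theorem (causal effect identification in ICM generative processes).** Consider the class of all ICM generative processes, with arbitrary and unknown DAG $\mathcal G$, whose law $P$ is faithful to $\mathrm{ICM}(\mathcal G)$ and is such that, for every $i$ and $N$, the joint density of the parents $\mathrm{PA}_{i;[N]}$ is positive $\mu$-almost everywhere (so that the conditional densities $p(\mathbf x_{i;[N]}\mid \mathrm{pa}_{i;[N]})$ are determined by $P$ at almost every value of the parents). Then, for all disjoint sets $\mathbf X,\mathbf Y$ of observables $X_{i;n}$, the causal query $P(\mathbf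 Y\mid do(\mathbf X=\mathbf x))$ is determined by $P$ alone: any two processes of this class with the same law $P$, possibly with different DAGs, parameters, priors and conditional densities, have the same $P(\mathbf Y\mid do(\mathbf X=\mathbf x))$ for $\mu$-almost every value $\mathbf x$ of $\mathbf X$ (for every value if the $\mathcal X_i$ are countable and the $\mu_i$ are counting measures). If $\mathbf X$ is infinite, "almost every" means: outside a set that is null for every probability law of $\mathbf x$ whose finite-dimensional marginals are absolutely continuous with respect to the product reference measures. -/

import Mathlib

open MeasureTheory ProbabilityTheory
open scoped ENNReal

/-! ### Mixed graphs and m-separation -/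

/-- A mixed graph: directed edges `a → b` and bidirected edges `a ↔ b`. -/
structure MixedGraph (V : Type*) where
  dir : V → V → Prop
  bi : V → V → Prop
  bi_symm : ∀ a b, bi a b → bi b a

namespace MixedGraph

variable {V : Type*}

/-- An edge between `a` and `b` with prescribed end marks; the Booleans say whether there is an
arrowhead at `a`, respectively at `b`. -/
def HasEdge (H : MixedGraph V) (a b : V) : Bool → Bool → Prop
  | false, true => H.dir a b
  | true, false => H.dir b a
  | true, true => H.bi a b
  | false, false => False

/-- There is a path (no repeated vertices) `v 0, …, v k` from `a` to `b` that is not blocked by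
`C`: every inner collider is in `C` or has a descendant in `C`, and no other inner vertex is
in `C`.  `l t` and `r t` are the marks of the `t`-th edge at `v t` and at `v (t + 1)`. -/
def Connected (H : MixedGraph V) (C : Set V) (a b : V) : Prop :=
  ∃ (k : ℕ) (v : ℕ → V) (l r : ℕ → Bool),
    v 0 = a ∧ v k = b ∧ Set.InjOn v (Set.Iic k) ∧
    (∀ t, t < k → H.HasEdge (v t) (v (t + 1)) (l t) (r t)) ∧
    (∀ t, t + 1 < k →
      if r t = true ∧ l (t + 1) = true then
        ∃ c ∈ C, Relation.ReflTransGen H.dir (v (t + 1)) c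
      else v (t + 1) ∉ C)

/-- `C` separates `A` from `B`: it blocks every path between them. -/
def Separated (H : MixedGraph V) (A B C : Set V) : Prop :=
  ∀ a ∈ A, ∀ b ∈ B, ¬ H.Connected C a b

end MixedGraph

/-- `ICM(G)`: a copy of `G` at every position, and `X_{i;n} ↔ X_{i;m}` for `n ≠ m`.
The vertex `(i, n)` stands for `X_{i;n}`. -/
def icmGraph {d : ℕ} (G : Digraph (Fin d)) : MixedGraph (Fin d × ℕ) where
  dir a b := a.2 = b.2 ∧ G.Adj a.1 b.1
  bi a b := a.1 = b.1 ∧ a.2 ≠ b.2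
  bi_symm _ _ h := ⟨h.1.symm, h.2.symm⟩

/-! ### Sequences of arrays, conditional independence and faithfulness -/

section

universe u

variable {d : ℕ}

/-- Realizations of the whole sequence: `x n i` is the value of `X_{i;n}`. -/
abbrev ArraySeq (𝒳 : Fin d → Type u) : Type u := ℕ → ∀ i, 𝒳 i

/-- Joint realizations of the observables in `S`. -/
abbrev Values (𝒳 : Fin d → Type u) (S : Set (Fin d × ℕ)) : Type u := ∀ v : S, 𝒳 v.1.1

/-- The observables in `S`, as a random variable on the space of sequences. -/
def obs {𝒳 : Fin d → Type u} (S : Set (Fin d × ℕ)) (x : ArraySeq 𝒳) : Values 𝒳 S :=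
  fun v => x v.1.2 v.1.1

variable {𝒳 : Fin d → Type u} [∀ i, MeasurableSpace (𝒳 i)]

theorem measurable_obs (S : Set (Fin d × ℕ)) : Measurable (obs S : ArraySeq 𝒳 → Values 𝒳 S) :=
  measurable_pi_lambda _ fun v => (measurable_pi_apply v.1.1).comp (measurable_pi_apply v.1.2)

/-- `X_A ⫫ X_B ∣ X_C` under `P`. -/
def CondIndepObs [∀ i, StandardBorelSpace (𝒳 i)] (P : Measure (ArraySeq 𝒳)) [IsFiniteMeasure P]
    (A B C : Set (Fin d × ℕ)) : Prop :=
  CondIndepFun (MeasurableSpace.comap (obs (𝒳 := 𝒳) C) inferInstance)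
    (measurable_obs C).comap_le (obs A) (obs B) P

/-- `P` is faithful to the mixed graph `H` on the observables: every conditional independence
among finitely many observables that holds in `P` is a separation in `H`. -/
def Faithful [∀ i, StandardBorelSpace (𝒳 i)] (P : Measure (ArraySeq 𝒳)) [IsFiniteMeasure P]
    (H : MixedGraph (Fin d × ℕ)) : Prop :=
  ∀ A B C : Finset (Fin d × ℕ), Disjoint A B → Disjoint A C → Disjoint B C →
    CondIndepObs P A B C → H.Separated A B C

/-- A property holds for almost every value of the observables in `S`, with respect to the
reference measures `μ i`.  If `S` is finite, this means almost everywhere for the product of the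
reference measures.  If `S` is infinite, that product need not exist, and the exceptional set is
required to be null for every law on the values whose finite-dimensional marginals are absolutely
continuous with respect to the finite products. -/
def AlmostEveryValue (μ : ∀ i, Measure (𝒳 i)) (S : Set (Fin d × ℕ))
    (Q : Values 𝒳 S → Prop) : Prop :=
  ∀ ρ : Measure (Values 𝒳 S), IsProbabilityMeasure ρ →
    (∀ F : Finset S, ρ.map (fun x (v : F) => x v.1) ≪ Measure.pi fun v : F => μ v.1.1.1) →
    ∀ᵐ x ∂ρ, Q x

end

/-! ### ICM generative processes -/

universe u w w'

/-- An ICM generative process over the observation spaces `𝒳 i` with reference measures `μ i`: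
a DAG `G` on the variable indices, for every `i` a parameter space with prior `ν i`, and a family
of conditional densities `p i θᵢ paᵢ xᵢ` of the `i`-th variable given its parents and parameter. -/
structure ICMProcess {d : ℕ} {𝒳 : Fin d → Type u} [∀ i, MeasurableSpace (𝒳 i)]
    (μ : ∀ i, Measure (𝒳 i)) where
  G : Digraph (Fin d)
  acyclic : ∀ i, ¬ Relation.TransGen G.Adj i i
  Θ : Fin d → Type w
  measurableSpaceΘ : ∀ i, MeasurableSpace (Θ i)
  ν : ∀ i, Measure (Θ i)
  isProbabilityMeasure_ν : ∀ i, IsProbabilityMeasure (ν i)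
  p : ∀ i, Θ i → (∀ j : {j // G.Adj j i}, 𝒳 j.1) → 𝒳 i → ℝ≥0∞
  measurable_p : ∀ i, Measurable fun z : Θ i × (∀ j : {j // G.Adj j i}, 𝒳 j.1) × 𝒳 i =>
    p i z.1 z.2.1 z.2.2
  lintegral_p : ∀ i θ pa, ∫⁻ x, p i θ pa x ∂μ i = 1

namespace ICMProcess

variable {d : ℕ} {𝒳 : Fin d → Type u} [∀ i, MeasurableSpace (𝒳 i)] {μ : ∀ i, Measure (𝒳 i)}

attribute [instance] measurableSpaceΘ isProbabilityMeasure_ν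

open Classical in
/-- Reference measures at position `n` under `do(X_S = x)`: a point mass at the assigned value for
every variable that is intervened on. -/
noncomputable def base (_M : ICMProcess.{u, w} μ) (S : Set (Fin d × ℕ)) (x : Values 𝒳 S) (n : ℕ)
    (i : Fin d) : Measure (𝒳 i) :=
  if h : (i, n) ∈ S then Measure.dirac (x ⟨(i, n), h⟩) else μ i

open Classical in
/-- The factor of the `i`-th variable at position `n` under `do(X_S = x)`, for parameter `θ`. -/
noncomputable def factor (M : ICMProcess.{u, w} μ) (S : Set (Fin d × ℕ)) (n : ℕ)
    (θ : ∀ i, M.Θ i) (i : Fin d) (y : ∀ i, 𝒳 i) : ℝ≥0∞ :=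
  if (i, n) ∈ S then 1 else M.p i (θ i) (fun j => y j.1) (y i)

/-- The law of the array at position `n` under `do(X_S = x)`, given the parameters `θ`. -/
noncomputable def positionLaw (M : ICMProcess.{u, w} μ) (S : Set (Fin d × ℕ)) (x : Values 𝒳 S)
    (θ : ∀ i, M.Θ i) (n : ℕ) : Measure (∀ i, 𝒳 i) :=
  (Measure.pi (M.base S x n)).withDensity fun y => ∏ i, M.factor S n θ i y

instance [∀ i, SigmaFinite (μ i)] (M : ICMProcess.{u, w} μ) (S : Set (Fin d × ℕ))
    (x : Values 𝒳 S) (n : ℕ) (i : Fin d) : SigmaFinite (M.base S x n i) := by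
  unfold base
  split_ifs <;> infer_instance

theorem measurable_factor (M : ICMProcess.{u, w} μ) (S : Set (Fin d × ℕ)) (n : ℕ) (i : Fin d) :
    Measurable fun z : (∀ i, M.Θ i) × (∀ i, 𝒳 i) => M.factor S n z.1 i z.2 := by
  unfold factor
  split_ifs
  · exact measurable_const
  · have h : Measurable fun z : (∀ i, M.Θ i) × (∀ i, 𝒳 i) =>
        ((z.1 i, (fun j => z.2 j.1, z.2 i)) :
          M.Θ i × (∀ j : {j // M.G.Adj j i}, 𝒳 j.1) × 𝒳 i) := by
      fun_prop
    exact (M.measurable_p i).comp h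

theorem nonempty_obs (M : ICMProcess.{u, w} μ) (θ : ∀ i, M.Θ i) (i : Fin d) :
    Nonempty (𝒳 i) := by
  have : Std.Irrefl (Relation.TransGen M.G.Adj) := ⟨M.acyclic⟩
  have wf := Finite.wellFounded_of_trans_of_irrefl (Relation.TransGen M.G.Adj)
  induction i using wf.induction with
  | _ i ih =>
    by_contra hne
    rw [not_nonempty_iff] at hne
    have h := M.lintegral_p i (θ i) fun j => (ih j.1 (.single j.2)).some
    rw [Measure.eq_zero_of_isEmpty (μ i)] at h
    simp at h

theorem lmarginal_factor [∀ i, SigmaFinite (μ i)] (M : ICMProcess.{u, w} μ)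
    (S : Set (Fin d × ℕ)) (x : Values 𝒳 S) (n : ℕ) (θ : ∀ i, M.Θ i) (k : ℕ) :
    ∀ (s : Finset (Fin d)), s.card = k → ∀ y,
      lmarginal (M.base S x n) s (fun y => ∏ i ∈ s, M.factor S n θ i y) y = 1 := by
  classical
  have hmeas : ∀ i, Measurable (M.factor S n θ i) := fun i =>
    (M.measurable_factor S n i).comp (measurable_const.prodMk measurable_id)
  induction k with
  | zero =>
    intro s hs y
    simp [Finset.card_eq_zero.mp hs]
  | succ k ih =>
    intro s hs y
    have : Std.Irrefl (Relation.TransGen (Function.swap M.G.Adj)) :=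
      ⟨fun i h => M.acyclic i (Relation.transGen_swap.mp h)⟩
    have wf := Finite.wellFounded_of_trans_of_irrefl
      (Relation.TransGen (Function.swap M.G.Adj))
    obtain ⟨i, hi, hmin⟩ := wf.has_min (s : Set (Fin d))
      (Finset.coe_nonempty.mpr (Finset.card_pos.mp (by omega)))
    have hsink : ∀ j ∈ s, ¬ M.G.Adj i j := fun j hj h => hmin j hj (.single h)
    have hi' : i ∈ s := hi
    obtain ⟨t, hit, rfl⟩ : ∃ t, i ∉ t ∧ insert i t = s :=
      ⟨s.erase i, Finset.notMem_erase i s, Finset.insert_erase hi'⟩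
    rw [lmarginal_insert' _ (Finset.measurable_prod _ fun j _ => hmeas j) hit]
    have hone : ∀ z, ∫⁻ c, M.factor S n θ i (Function.update z i c) ∂(M.base S x n i) = 1 := by
      intro z
      by_cases h : (i, n) ∈ S
      · simp [factor, base, h]
      · simp only [factor, base, h, if_false, dif_neg, not_false_eq_true,
          Function.update_self]
        rw [← M.lintegral_p i (θ i) fun j => z j.1]
        congr 1
        ext c
        congr 1
        ext j
        rw [Function.update_of_ne]
        intro hj
        exact hsink i (Finset.mem_insert_self i t) (by simpa [hj] using j.2)
    have hother : ∀ j ∈ t, ∀ z c,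
        M.factor S n θ j (Function.update z i c) = M.factor S n θ j z := by
      intro j hj z c
      have hji : j ≠ i := fun h => hit (h ▸ hj)
      unfold factor
      split_ifs
      · rfl
      · rw [Function.update_of_ne hji]
        congr 1
        ext a
        rw [Function.update_of_ne]
        intro ha
        exact hsink j (Finset.mem_insert_of_mem hj) (by simpa [ha] using a.2)
    have heq : (fun z => ∫⁻ c, ∏ j ∈ insert i t, M.factor S n θ j (Function.update z i c)
        ∂(M.base S x n i)) = fun z => ∏ j ∈ t, M.factor S n θ j z := by
      ext z
      simp only [Finset.prod_insert hit]
      have : ∀ c, ∏ j ∈ t, M.factor S n θ j (Function.update z i c)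
          = ∏ j ∈ t, M.factor S n θ j z := fun c => Finset.prod_congr rfl fun j hj => hother j hj z c
      simp only [this]
      have hm : Measurable fun c => M.factor S n θ i (Function.update z i c) :=
        (hmeas i).comp (measurable_update z)
      rw [lintegral_mul_const _ hm, hone, one_mul]
    rw [heq]
    exact ih t (by rw [Finset.card_insert_of_notMem hit] at hs; omega) y

instance [∀ i, SigmaFinite (μ i)] (M : ICMProcess.{u, w} μ) (S : Set (Fin d × ℕ))
    (x : Values 𝒳 S) (θ : ∀ i, M.Θ i) (n : ℕ) : IsProbabilityMeasure (M.positionLaw S x θ n) := by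
  constructor
  have y : ∀ i, 𝒳 i := fun i => (M.nonempty_obs θ i).some
  rw [positionLaw, withDensity_apply _ MeasurableSet.univ, Measure.restrict_univ,
    lintegral_eq_lmarginal_univ y]
  exact M.lmarginal_factor S x n θ _ Finset.univ rfl y

variable [∀ i, SigmaFinite (μ i)]

/-- The law of the whole sequence under `do(X_S = x)`: independent parameters `θ i ∼ ν i` are
drawn once, and given them the arrays at the different positions are independent. -/
noncomputable def doLaw (M : ICMProcess.{u, w} μ) (S : Set (Fin d × ℕ)) (x : Values 𝒳 S) :
    Measure (ArraySeq 𝒳) :=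
  (Measure.pi M.ν).bind fun θ => Measure.infinitePi (M.positionLaw S x θ)

theorem measurable_infinitePi_positionLaw (M : ICMProcess.{u, w} μ) (S : Set (Fin d × ℕ))
    (x : Values 𝒳 S) :
    Measurable fun θ => Measure.infinitePi (M.positionLaw S x θ) := by
  refine Measurable.measure_of_isPiSystem_of_isProbabilityMeasure
    generateFrom_squareCylinders.symm
    (isPiSystem_squareCylinders (fun _ => MeasurableSpace.isPiSystem_measurableSet)
      fun _ => by simp) ?_
  rintro _ ⟨s, t, ht, rfl⟩
  have ht' : ∀ n, MeasurableSet (t n) := fun n => ht n (Set.mem_univ n)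
  simp only [Measure.infinitePi_pi _ fun n _ => ht' n]
  refine Finset.measurable_prod _ fun n _ => ?_
  simp only [positionLaw, withDensity_apply _ (ht' n)]
  exact Measurable.lintegral_prod_right'
    (f := fun z : (∀ i, M.Θ i) × (∀ i, 𝒳 i) => ∏ i, M.factor S n z.1 i z.2)
    (Finset.measurable_prod _ fun i _ => M.measurable_factor S n i)

instance (M : ICMProcess.{u, w} μ) (S : Set (Fin d × ℕ)) (x : Values 𝒳 S) :
    IsProbabilityMeasure (M.doLaw S x) :=
  isProbabilityMeasure_bind (M.measurable_infinitePi_positionLaw S x).aemeasurable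
    (.of_forall fun _ => inferInstance)

/-- The observational law `P` of the sequence (no intervention). -/
noncomputable def law (M : ICMProcess.{u, w} μ) : Measure (ArraySeq 𝒳) :=
  M.doLaw ∅ fun v => v.2.elim

instance (M : ICMProcess.{u, w} μ) : IsProbabilityMeasure M.law :=
  inferInstanceAs (IsProbabilityMeasure (M.doLaw ∅ _))

/-- The causal effect `P(X_T ∣ do(X_S = x))`. -/
noncomputable def effect (M : ICMProcess.{u, w} μ) (T S : Set (Fin d × ℕ)) (x : Values 𝒳 S) :
    Measure (Values 𝒳 T) :=
  (M.doLaw S x).map (obs T)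

/-- The parents `PA_{i;[N]}` of the `i`-th variable at the first `N` positions. -/
noncomputable def parents (M : ICMProcess.{u, w} μ) (i : Fin d) (N : ℕ) : Finset (Fin d × ℕ) :=
  open Classical in (Finset.univ.filter fun j => M.G.Adj j i) ×ˢ Finset.range N

/-- The joint density of `PA_{i;[N]}` is positive almost everywhere, for all `i` and `N`; that is,
the conditional densities `p(x_{i;[N]} ∣ pa_{i;[N]})` of the observational law are determined at
almost every value of the parents. -/
def ParentPositive (M : ICMProcess.{u, w} μ) : Prop :=
  ∀ (i : Fin d) (N : ℕ),
    (Measure.pi fun v : M.parents i N => μ v.1.1) ≪ M.law.map (fun x v => x v.1.2 v.1.1)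

end ICMProcess

/-!
The proof has two parts: the law determines the graph, and then the law and the graph determine
every factor of the densities of the interventional laws.

All objects are compared with one probability measure. The reference measures may be replaced by
equivalent probability measures (`ICMProcess.reweight`), and then `refLaw`, under which all
observables are independent, is a probability measure on the space of sequences. Fixing the values
of some observables is the map `fill`, and redrawing some of them independently (`splice`) leaves
`refLaw` invariant. Fubini's theorem for finitely many coordinates takes this form
(`lintegral_refLaw_splice`).

For a finite set `E` of observables let `mixDensity E` be the product of their conditional
densities, averaged over the parameters. If `E` is closed under parents, it is the joint density of
`X_E` under the observational law (`lintegral_law`); for the observables outside of `S` at the first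
`N` positions it is their joint density under `do(X_S = x)` (`lintegral_doLaw`). Since the
parameters of different variables are independent, `mixDensity E` is a product over the variables
`i`, and the `i`-th factor involves the observables of the `i`-th variable and of its parents only.
Hence `X_{i;A}` may be redrawn from that factor without changing its joint law with the
non-descendants of `i` (`lintegral_law_eq_resample`). Both parts rest on this lemma.

For the graph, it shows that `X_{i;0}` is independent of each non-descendant, at position `0` or at
any other position, given its parents at position `0` (`condIndepObs_parents`). If `i → j` were an
edge of the first graph but not of the second, the second process would have either
`X_{j;0} ⫫ X_{i;0}` or `X_{i;0} ⫫ X_{j;1}` given observables at position `0`. The edge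
`X_{i;0} → X_{j;0}`, respectively the path `X_{i;0} ↔ X_{i;1} → X_{j;1}`, contradicts the
faithfulness of the law to the first graph (`adj_of_adj`).

For the factors, the lemma shows that `mixDensity ({i} ×ˢ A)` is determined by the law almost
everywhere with respect to the law of the parents times the reference measures, and positivity of
the density of the parents makes this almost everywhere for `refLaw` (`mixDensity_ae_eq`). By
Fubini's theorem the densities at the first `N` positions under `do(X_S = x)` agree for almost every
`x` (`ae_fill_of_ae_refLaw`), simultaneously for all `N` (`doLaw_ae_eq`).
-/

/-! ### Densities and boxes in product measures -/

section ProductMeasures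

theorem lintegral_infinitePi_finset_prod {ι : Type*} {α : ι → Type*}
    [∀ i, MeasurableSpace (α i)] (m : ∀ i, Measure (α i)) [∀ i, IsProbabilityMeasure (m i)]
    (s : Finset ι) {f : ∀ i, α i → ℝ≥0∞} (hf : ∀ i, Measurable (f i)) :
    ∫⁻ x, ∏ i ∈ s, f i (x i) ∂Measure.infinitePi m = ∏ i ∈ s, ∫⁻ a, f i a ∂m i := by
  have hm : ∀ i, Measurable fun x : ∀ i, α i => f i (x i) :=
    fun i => (hf i).comp (measurable_pi_apply i)
  refine (lintegral_prod_eq_prod_lintegral_of_indepFun s (fun i (x : ∀ i, α i) => f i (x i))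
    (iIndepFun_infinitePi hf) hm).trans ?_
  refine Finset.prod_congr rfl fun i _ => ?_
  rw [← lintegral_map (hf i) (measurable_pi_apply i), Measure.infinitePi_map_eval]

/-- Replacing finitely many factors of an infinite product by measures with densities multiplies
the product by a density; with infinitely many factors absolute continuity can fail. -/
theorem infinitePi_withDensity_finset {ι : Type*} {α : ι → Type*}
    [∀ i, MeasurableSpace (α i)] (m m' : ∀ i, Measure (α i)) [∀ i, IsProbabilityMeasure (m i)]
    [∀ i, IsProbabilityMeasure (m' i)] (s : Finset ι) {h : ∀ i, α i → ℝ≥0∞}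
    (hh : ∀ i, Measurable (h i)) (hs : ∀ i ∈ s, m' i = (m i).withDensity (h i))
    (hs' : ∀ i ∉ s, m' i = m i) :
    Measure.infinitePi m' = (Measure.infinitePi m).withDensity fun x => ∏ i ∈ s, h i (x i) := by
  classical
  refine (Measure.eq_infinitePi m' fun t B hB => ?_).symm
  have hbox : MeasurableSet (Set.pi (t : Set ι) B) := .pi t.countable_toSet fun i _ => hB i
  set g : ∀ i, α i → ℝ≥0∞ := fun i a =>
    (if i ∈ t then (B i).indicator 1 a else 1) * (if i ∈ s then h i a else 1) with hg
  have hgm : ∀ i, Measurable (g i) := by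
    intro i
    simp only [hg]
    have := (measurable_one (α := ℝ≥0∞) (β := α i)).indicator (hB i)
    split_ifs <;> fun_prop
  rw [withDensity_apply _ hbox, ← lintegral_indicator hbox]
  have h1 : ∀ x, (Set.pi (t : Set ι) B).indicator (fun x => ∏ i ∈ s, h i (x i)) x
      = ∏ i ∈ t ∪ s, g i (x i) := by
    intro x
    rw [Finset.prod_mul_distrib]
    have e1 : ∏ i ∈ t ∪ s, (if i ∈ s then h i (x i) else 1) = ∏ i ∈ s, h i (x i) := by
      rw [Finset.prod_ite_mem, Finset.inter_eq_right.2 Finset.subset_union_right]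
    have e2 : ∏ i ∈ t ∪ s, (if i ∈ t then (B i).indicator (1 : α i → ℝ≥0∞) (x i) else 1)
        = ∏ i ∈ t, (B i).indicator (1 : α i → ℝ≥0∞) (x i) := by
      rw [Finset.prod_ite_mem, Finset.inter_eq_right.2 Finset.subset_union_left]
    rw [e1, e2]
    by_cases hx : x ∈ Set.pi (t : Set ι) B
    · rw [Set.indicator_of_mem hx, Finset.prod_congr rfl fun i hi =>
        Set.indicator_of_mem (hx i hi) (1 : α i → ℝ≥0∞)]
      simp
    · rw [Set.indicator_of_notMem hx]
      simp only [Set.mem_pi, not_forall] at hx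
      obtain ⟨i, hi, hxi⟩ := hx
      rw [Finset.prod_eq_zero (i := i) hi (by simp [hxi]), zero_mul]
  simp only [h1]
  rw [lintegral_infinitePi_finset_prod m _ hgm]
  have h2 : ∀ i, ∫⁻ a, g i a ∂m i = if i ∈ t then m' i (B i) else 1 := by
    intro i
    by_cases hi : i ∈ s
    · rw [hs i hi]
      by_cases hit : i ∈ t
      · simp only [hg, hi, hit, if_true, withDensity_apply _ (hB i)]
        rw [← lintegral_indicator (hB i)]
        congr 1 with a
        by_cases ha : a ∈ B i <;> simp [ha]
      · simp only [hg, hi, hit, if_true, if_false, one_mul]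
        rw [← setLIntegral_univ, ← withDensity_apply _ .univ, ← hs i hi, measure_univ]
    · rw [hs' i hi]
      by_cases hit : i ∈ t
      · simp [hg, hi, hit, lintegral_indicator_one (hB i)]
      · simp [hg, hi, hit]
  simp only [h2]
  rw [Finset.prod_ite_mem, Finset.inter_eq_right.2 Finset.subset_union_left]

/-- The integral of a function of the coordinates in `s` depends only on the factors in `s`. -/
theorem lintegral_infinitePi_congr {ι : Type*} {α : ι → Type*}
    [∀ i, MeasurableSpace (α i)] (m m' : ∀ i, Measure (α i)) [∀ i, IsProbabilityMeasure (m i)]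
    [∀ i, IsProbabilityMeasure (m' i)] (s : Finset ι) (hs : ∀ i ∈ s, m i = m' i)
    {F : (∀ i, α i) → ℝ≥0∞} (hF : Measurable F) (hFs : DependsOn F s) :
    ∫⁻ x, F x ∂Measure.infinitePi m = ∫⁻ x, F x ∂Measure.infinitePi m' := by
  classical
  obtain ⟨x₀⟩ := nonempty_of_isProbabilityMeasure (Measure.infinitePi m)
  have hres : ∀ x, F x = F (Function.updateFinset x₀ s (s.restrict x)) := by
    intro x
    refine hFs fun i hi => ?_
    have hi' : i ∈ s := hi
    simp [Function.updateFinset, hi']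
  have hm : Measurable fun y : ∀ i : s, α i => F (Function.updateFinset x₀ s y) :=
    hF.comp measurable_updateFinset
  have hr : ∀ (m : ∀ i, Measure (α i)) [∀ i, IsProbabilityMeasure (m i)],
      ∫⁻ x, F (Function.updateFinset x₀ s (s.restrict x)) ∂Measure.infinitePi m
        = ∫⁻ y, F (Function.updateFinset x₀ s y) ∂Measure.pi fun i : s => m i :=
    fun m _ => lintegral_restrict_infinitePi m hm
  rw [lintegral_congr hres, lintegral_congr hres, hr, hr]
  have : (fun i : s => m i) = fun i : s => m' i := funext fun i => hs i i.2
  congr 2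

theorem lintegral_infinitePi_withDensity {ι : Type*} {α : ι → Type*}
    [∀ i, MeasurableSpace (α i)] (m m' : ∀ i, Measure (α i)) [∀ i, IsProbabilityMeasure (m i)]
    [∀ i, IsProbabilityMeasure (m' i)] (s : Finset ι) {h : ∀ i, α i → ℝ≥0∞}
    (hh : ∀ i, Measurable (h i)) (hs : ∀ i, m' i = (m i).withDensity (h i))
    {F : (∀ i, α i) → ℝ≥0∞} (hF : Measurable F) (hFs : DependsOn F s) :
    ∫⁻ x, F x ∂Measure.infinitePi m'
      = ∫⁻ x, F x * ∏ i ∈ s, h i (x i) ∂Measure.infinitePi m := by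
  classical
  have hP : ∀ i, IsProbabilityMeasure (if i ∈ s then m' i else m i) := by
    intro i; split_ifs <;> infer_instance
  have hm : Measurable fun x : ∀ i, α i => ∏ i ∈ s, h i (x i) :=
    Finset.measurable_fun_prod _ fun i _ => (hh i).comp (measurable_pi_apply i)
  rw [lintegral_infinitePi_congr m' (fun i => if i ∈ s then m' i else m i) s
      (fun i hi => by simp [hi]) hF hFs,
    infinitePi_withDensity_finset m (fun i => if i ∈ s then m' i else m i) s hh
      (fun i hi => by simp [hi, hs i]) (fun i hi => by simp [hi]),
    lintegral_withDensity_eq_lintegral_mul _ hm hF]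
  simp [mul_comm]

theorem pi_withDensity_of_probability {ι : Type*} [Fintype ι] {α : ι → Type*}
    [∀ i, MeasurableSpace (α i)] (m m' : ∀ i, Measure (α i)) [∀ i, IsProbabilityMeasure (m i)]
    [∀ i, SigmaFinite (m' i)] {h : ∀ i, α i → ℝ≥0∞}
    (hh : ∀ i, Measurable (h i)) (hs : ∀ i, m' i = (m i).withDensity (h i)) :
    Measure.pi m' = (Measure.pi m).withDensity fun x => ∏ i, h i (x i) := by
  classical
  refine Measure.pi_eq fun B hB => ?_
  have hbox : MeasurableSet (Set.pi Set.univ B) := .univ_pi hB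
  rw [withDensity_apply _ hbox, ← lintegral_indicator hbox]
  have h1 : ∀ x, (Set.pi Set.univ B).indicator (fun x => ∏ i, h i (x i)) x
      = ∏ i, (B i).indicator (h i) (x i) := by
    intro x
    by_cases hx : x ∈ Set.pi Set.univ B
    · rw [Set.indicator_of_mem hx]
      exact Finset.prod_congr rfl fun i _ => (Set.indicator_of_mem (hx i trivial) _).symm
    · rw [Set.indicator_of_notMem hx]
      simp only [Set.mem_pi, not_forall] at hx
      obtain ⟨i, -, hxi⟩ := hx
      rw [Finset.prod_eq_zero (Finset.mem_univ i) (Set.indicator_of_notMem hxi _)]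
  simp only [h1]
  rw [← Measure.infinitePi_eq_pi,
    lintegral_infinitePi_finset_prod m _ fun i => (hh i).indicator (hB i)]
  refine Finset.prod_congr rfl fun i _ => ?_
  rw [lintegral_indicator (hB i), hs i, withDensity_apply _ (hB i)]

section Arrays

variable {κ : Type*} [Fintype κ] {α : κ → Type*} [∀ i, MeasurableSpace (α i)]

theorem map_piCurry_symm_infinitePi_pi (m : ℕ → ∀ i, Measure (α i))
    [∀ n i, IsProbabilityMeasure (m n i)] :
    (Measure.infinitePi fun n => Measure.pi (m n)).map
        (fun z (p : (_ : ℕ) × κ) => z p.1 p.2)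
      = Measure.infinitePi fun p : (_ : ℕ) × κ => m p.1 p.2 := by
  simp only [← Measure.infinitePi_eq_pi]
  exact Measure.infinitePi_map_piCurry_symm (X := fun (_ : ℕ) i => α i) m

/-- A measure on sequences of tuples is the product of products of `m n i` as soon as it has the
right value on all finite-dimensional boxes whose sides are indexed by position and index. -/
theorem eq_infinitePi_pi (m : ℕ → ∀ i, Measure (α i)) [∀ n i, IsProbabilityMeasure (m n i)]
    {ρ : Measure (ℕ → ∀ i, α i)}
    (hρ : ∀ (s : Finset ((_ : ℕ) × κ)) (t : ∀ p : (_ : ℕ) × κ, Set (α p.2)),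
      (∀ p, MeasurableSet (t p)) →
      ρ {z | ∀ p ∈ s, z p.1 p.2 ∈ t p} = ∏ p ∈ s, m p.1 p.2 (t p)) :
    ρ = Measure.infinitePi fun n => Measure.pi (m n) := by
  simp only [← Measure.infinitePi_eq_pi]
  rw [← Measure.infinitePi_map_piCurry (X := fun (_ : ℕ) i => α i) m,
    eq_comm, MeasurableEquiv.map_apply_eq_iff_map_symm_apply_eq, eq_comm]
  refine Measure.eq_infinitePi _ fun s t ht => ?_
  rw [Measure.map_apply (MeasurableEquiv.measurable _) (.pi s.countable_toSet fun i _ => ht i),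
    ← hρ s t ht]
  rfl

theorem infinitePi_pi_box (m : ℕ → ∀ i, Measure (α i)) [∀ n i, IsProbabilityMeasure (m n i)]
    (s : Finset ((_ : ℕ) × κ)) {t : ∀ p : (_ : ℕ) × κ, Set (α p.2)}
    (ht : ∀ p, MeasurableSet (t p)) :
    (Measure.infinitePi fun n => Measure.pi (m n)) {z | ∀ p ∈ s, z p.1 p.2 ∈ t p}
      = ∏ p ∈ s, m p.1 p.2 (t p) := by
  rw [← Measure.infinitePi_pi _ fun p _ => ht p, ← map_piCurry_symm_infinitePi_pi,
    Measure.map_apply (by fun_prop) (.pi s.countable_toSet fun i _ => ht i)]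
  rfl

end Arrays

end ProductMeasures

/-! ### Overwriting observables, and the reference law -/

section References

variable {d : ℕ} {𝒳 : Fin d → Type u}

/-- `F` is a function of the observables in `E` only. -/
def DependsOnObs {β : Sort*} (F : ArraySeq 𝒳 → β) (E : Set (Fin d × ℕ)) : Prop :=
  ∀ ⦃y z : ArraySeq 𝒳⦄, (∀ v ∈ E, y v.2 v.1 = z v.2 v.1) → F y = F z

theorem DependsOnObs.mono {β : Sort*} {F : ArraySeq 𝒳 → β} {E E' : Set (Fin d × ℕ)}
    (h : DependsOnObs F E) (hE : E ⊆ E') : DependsOnObs F E' :=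
  fun _ _ hyz => h fun v hv => hyz v (hE hv)

theorem dependsOnObs_obs (E : Set (Fin d × ℕ)) : DependsOnObs (obs (𝒳 := 𝒳) E) E :=
  fun _ _ hyz => funext fun v => hyz v.1 v.2

theorem DependsOnObs.comp {β γ : Sort*} {F : ArraySeq 𝒳 → β} {E : Set (Fin d × ℕ)}
    (h : DependsOnObs F E) (g : β → γ) : DependsOnObs (fun z => g (F z)) E :=
  fun _ _ hyz => congrArg g (h hyz)

theorem DependsOnObs.mul {F G : ArraySeq 𝒳 → ℝ≥0∞} {E : Set (Fin d × ℕ)}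
    (hF : DependsOnObs F E) (hG : DependsOnObs G E) : DependsOnObs (fun z => F z * G z) E :=
  fun _ _ hyz => congrArg₂ _ (hF hyz) (hG hyz)

theorem DependsOnObs.indicator {a : Set (ArraySeq 𝒳)} {E : Set (Fin d × ℕ)}
    (h : DependsOnObs (· ∈ a) E) : DependsOnObs (a.indicator (1 : ArraySeq 𝒳 → ℝ≥0∞)) E := by
  intro y z hyz
  have hiff : y ∈ a ↔ z ∈ a := iff_of_eq (h hyz)
  by_cases hy : y ∈ a
  · simp [hy, hiff.1 hy]
  · simp [hy, mt hiff.2 hy]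

theorem dependsOnObs_preimage_obs {E : Set (Fin d × ℕ)} (a : Set (Values 𝒳 E)) :
    DependsOnObs (· ∈ obs E ⁻¹' a) E :=
  (dependsOnObs_obs E).comp (· ∈ a)

open Classical in
/-- The sequence with the values `x` of the observables in `S` and the values given by `y` of all
other observables. -/
noncomputable def fill (S : Set (Fin d × ℕ)) (x : Values 𝒳 S) (y : ArraySeq 𝒳) : ArraySeq 𝒳 :=
  fun n i => if h : (i, n) ∈ S then x ⟨(i, n), h⟩ else y n i

theorem fill_of_mem {S : Set (Fin d × ℕ)} (x : Values 𝒳 S) (y : ArraySeq 𝒳) {i : Fin d} {n : ℕ}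
    (h : (i, n) ∈ S) : fill S x y n i = x ⟨(i, n), h⟩ := dif_pos h

theorem fill_of_notMem {S : Set (Fin d × ℕ)} (x : Values 𝒳 S) (y : ArraySeq 𝒳) {i : Fin d} {n : ℕ}
    (h : (i, n) ∉ S) : fill S x y n i = y n i := dif_neg h

theorem DependsOnObs.apply_fill_obs {β : Sort*} {F : ArraySeq 𝒳 → β} {E : Set (Fin d × ℕ)}
    (h : DependsOnObs F E) (z y : ArraySeq 𝒳) : F (fill E (obs E z) y) = F z :=
  h fun _ hv => fill_of_mem _ _ hv

/-- The sequence that agrees with `z` on the observables in `S` and with `y` elsewhere. -/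
noncomputable def splice (S : Set (Fin d × ℕ)) (z y : ArraySeq 𝒳) : ArraySeq 𝒳 :=
  fill S (obs S z) y

theorem splice_of_mem {S : Set (Fin d × ℕ)} (z y : ArraySeq 𝒳) {i : Fin d} {n : ℕ}
    (h : (i, n) ∈ S) : splice S z y n i = z n i := fill_of_mem _ _ h

theorem splice_of_notMem {S : Set (Fin d × ℕ)} (z y : ArraySeq 𝒳) {i : Fin d} {n : ℕ}
    (h : (i, n) ∉ S) : splice S z y n i = y n i := fill_of_notMem _ _ h

theorem DependsOnObs.apply_splice_of_disjoint {β : Sort*} {F : ArraySeq 𝒳 → β}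
    {E S : Set (Fin d × ℕ)} (h : DependsOnObs F E) (hES : Disjoint E S) (z y : ArraySeq 𝒳) :
    F (splice S z y) = F y :=
  h fun _ hv => splice_of_notMem z y (Set.disjoint_left.1 hES hv)

variable [∀ i, MeasurableSpace (𝒳 i)]

theorem measurable_fill (S : Set (Fin d × ℕ)) :
    Measurable fun q : Values 𝒳 S × ArraySeq 𝒳 => fill S q.1 q.2 := by
  refine measurable_pi_lambda _ fun n => measurable_pi_lambda _ fun i => ?_
  by_cases h : (i, n) ∈ S
  · simp only [fill_of_mem _ _ h]; fun_prop
  · simp only [fill_of_notMem _ _ h]; fun_prop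

theorem measurable_splice (S : Set (Fin d × ℕ)) :
    Measurable fun q : ArraySeq 𝒳 × ArraySeq 𝒳 => splice S q.1 q.2 :=
  (measurable_fill S).comp
    (((measurable_obs S).comp measurable_fst).prodMk measurable_snd)

variable (μ : ∀ i, Measure (𝒳 i)) [∀ i, IsProbabilityMeasure (μ i)]

/-- The law under which all observables are independent and distributed according to the
(probability) reference measures. -/
noncomputable def refLaw : Measure (ArraySeq 𝒳) :=
  Measure.infinitePi fun _ : ℕ => Measure.pi μ

instance : IsProbabilityMeasure (refLaw μ) := by unfold refLaw; infer_instance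

theorem map_obs_refLaw (F : Finset (Fin d × ℕ)) :
    (refLaw μ).map (fun z (v : F) => z v.1.2 v.1.1) = Measure.pi fun v : F => μ v.1.1 := by
  have h1 := map_piCurry_symm_infinitePi_pi (fun _ : ℕ => μ)
  have h2 := Measure.map_infinitePi_infinitePi_of_inj
    (P := fun p : (_ : ℕ) × Fin d => μ p.2)
    (f := fun v : Fin d × ℕ => (⟨v.2, v.1⟩ : (_ : ℕ) × Fin d))
    (fun v v' h => by
      simp only [Sigma.mk.injEq, heq_eq_eq] at h
      exact Prod.ext h.2 h.1)
  have h3 := Measure.infinitePi_map_restrict (fun v : Fin d × ℕ => μ v.1) (I := F)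
  rw [← h3, ← h2, ← h1, Measure.map_map (by fun_prop) (by fun_prop),
    Measure.map_map (by fun_prop) (by fun_prop)]
  rfl

theorem map_eval_refLaw (v : Fin d × ℕ) :
    (refLaw μ).map (fun z => z v.2 v.1) = μ v.1 := by
  have h : Measurable fun z : ArraySeq 𝒳 => z v.2 := measurable_pi_apply v.2
  have h1 : (refLaw μ).map (fun z => z v.2) = Measure.pi μ :=
    Measure.infinitePi_map_eval (fun _ : ℕ => Measure.pi μ) v.2
  have h2 := (measurePreserving_eval μ v.1).map_eq
  rw [← h1, Measure.map_map (measurable_pi_apply _) h] at h2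
  exact h2

/-- Replacing the observables in `S` by an independent copy does not change the law under which
all observables are independent. -/
theorem map_splice_refLaw (S : Set (Fin d × ℕ)) :
    ((refLaw μ).prod (refLaw μ)).map (fun q => splice S q.1 q.2) = refLaw μ := by
  classical
  refine eq_infinitePi_pi (fun _ => μ) fun s t ht => ?_
  have hbox : ∀ s : Finset ((_ : ℕ) × Fin d),
      MeasurableSet {z : ArraySeq 𝒳 | ∀ p ∈ s, z p.1 p.2 ∈ t p} := by
    intro s
    have : {z : ArraySeq 𝒳 | ∀ p ∈ s, z p.1 p.2 ∈ t p}
        = ⋂ p ∈ s, (fun z : ArraySeq 𝒳 => z p.1 p.2) ⁻¹' t p := by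
      ext z; simp
    rw [this]
    refine Finset.measurableSet_biInter _ fun p _ => ?_
    exact ((measurable_pi_apply p.2).comp (measurable_pi_apply p.1)) (ht p)
  rw [Measure.map_apply (measurable_splice S) (hbox s)]
  have hpre : (fun q : ArraySeq 𝒳 × ArraySeq 𝒳 => splice S q.1 q.2) ⁻¹'
        {z | ∀ p ∈ s, z p.1 p.2 ∈ t p}
      = {z | ∀ p ∈ s.filter fun p => (p.2, p.1) ∈ S, z p.1 p.2 ∈ t p} ×ˢ
        {z | ∀ p ∈ s.filter fun p => (p.2, p.1) ∉ S, z p.1 p.2 ∈ t p} := by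
    ext ⟨z, y⟩
    simp only [Set.mem_preimage, Set.mem_ofPred_eq, Set.mem_prod, Finset.mem_filter]
    constructor
    · intro h
      refine ⟨fun p hp => ?_, fun p hp => ?_⟩
      · have := h p hp.1
        rwa [splice_of_mem _ _ hp.2] at this
      · have := h p hp.1
        rwa [splice_of_notMem _ _ hp.2] at this
    · intro h p hp
      by_cases hpS : (p.2, p.1) ∈ S
      · rw [splice_of_mem _ _ hpS]; exact h.1 p ⟨hp, hpS⟩
      · rw [splice_of_notMem _ _ hpS]; exact h.2 p ⟨hp, hpS⟩
  rw [hpre, Measure.prod_prod, refLaw, infinitePi_pi_box (fun _ => μ) _ ht,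
    infinitePi_pi_box (fun _ => μ) _ ht, Finset.prod_filter_mul_prod_filter_not]

theorem lintegral_refLaw_splice (S : Set (Fin d × ℕ)) {F : ArraySeq 𝒳 → ℝ≥0∞}
    (hF : Measurable F) :
    ∫⁻ y, ∫⁻ z, F (splice S z y) ∂refLaw μ ∂refLaw μ = ∫⁻ z, F z ∂refLaw μ := by
  have h := measurable_splice (𝒳 := 𝒳) S
  rw [← lintegral_prod_symm (fun q : ArraySeq 𝒳 × ArraySeq 𝒳 => F (splice S q.1 q.2))
      (hF.comp h).aemeasurable, ← lintegral_map hF h, map_splice_refLaw]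

/-- Variant of `lintegral_refLaw_splice` in which the observables outside of `S` are integrated
first. -/
theorem lintegral_refLaw_splice' (S : Set (Fin d × ℕ)) {F : ArraySeq 𝒳 → ℝ≥0∞}
    (hF : Measurable F) :
    ∫⁻ z, ∫⁻ y, F (splice S z y) ∂refLaw μ ∂refLaw μ = ∫⁻ z, F z ∂refLaw μ := by
  have h := measurable_splice (𝒳 := 𝒳) S
  rw [← lintegral_prod (fun q : ArraySeq 𝒳 × ArraySeq 𝒳 => F (splice S q.1 q.2))
      (hF.comp h).aemeasurable, ← lintegral_map hF h, map_splice_refLaw]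

/-- A property of the observables that holds almost everywhere for the reference measures keeps
holding, for almost every value `x` of the observables in `S` and almost all values of the others,
after fixing the observables in `S` to `x`. -/
theorem ae_fill_of_ae_refLaw (S : Set (Fin d × ℕ)) {N : ℕ} {B : Set (ArraySeq 𝒳)}
    (hB : MeasurableSet B) (hBN : DependsOnObs (· ∈ B) {v | v.2 < N}) (hB0 : refLaw μ B = 0) :
    AlmostEveryValue μ S fun x => ∀ᵐ y ∂refLaw μ, fill S x y ∉ B := by
  classical
  intro ρ hρ hρμ
  set b : Values 𝒳 S → ℝ≥0∞ := fun x => refLaw μ {y | fill S x y ∈ B} with hb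
  have hbm : Measurable b := measurable_measure_prodMk_left (measurable_fill S hB)
  have hb_obs : ∫⁻ z, b (obs S z) ∂refLaw μ = 0 := by
    have h := lintegral_refLaw_splice' μ S (measurable_one.indicator hB)
    rw [lintegral_indicator_one hB, hB0] at h
    rw [← h]
    refine lintegral_congr fun z => ?_
    have hm : MeasurableSet {y | fill S (obs S z) y ∈ B} :=
      measurable_prodMk_left (measurable_fill S hB)
    exact (lintegral_indicator_one hm).symm
  -- `b` depends on the finitely many observables of `S` in `F` only, and the law of these under
  -- `refLaw` is the product measure that dominates their law under `ρ`.
  let F : Finset S := (Finset.univ ×ˢ Finset.range N).subtype (· ∈ S)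
  have hmemF : ∀ v : S, v ∈ F ↔ v.1.2 < N := fun v => by simp [F]
  obtain ⟨x₀⟩ := nonempty_of_isProbabilityMeasure ρ
  let ext : (∀ v : F, 𝒳 v.1.1.1) → Values 𝒳 S := fun w v => if h : v ∈ F then w ⟨v, h⟩ else x₀ v
  have hext : Measurable ext := by
    refine measurable_pi_lambda _ fun v => ?_
    by_cases h : v ∈ F
    · simp only [ext, h, dif_pos]; fun_prop
    · simp only [ext, h, dif_neg, not_false_eq_true]; fun_prop
  have hbext : ∀ x, b (ext fun v => x v.1) = b x := by
    intro x
    simp only [hb]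
    congr 1
    ext y
    refine iff_of_eq (hBN fun v hv => ?_)
    by_cases hvS : v ∈ S
    · have : (⟨v, hvS⟩ : S) ∈ F := (hmemF _).2 hv
      rw [fill_of_mem _ _ hvS, fill_of_mem _ _ hvS]
      simp [ext, this]
    · rw [fill_of_notMem _ _ hvS, fill_of_notMem _ _ hvS]
  have hmap : (refLaw μ).map (fun z (v : F) => z v.1.1.2 v.1.1.1)
      = Measure.pi fun v : F => μ v.1.1.1 := by
    let e : F → (Finset.univ ×ˢ Finset.range N : Finset (Fin d × ℕ)) :=
      fun v => ⟨v.1.1, by simpa using (hmemF _).1 v.2⟩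
    have he : Function.Injective e := fun v v' h =>
      have h' : (e v).1 = (e v').1 := by rw [h]
      Subtype.ext (Subtype.ext h')
    have h1 := Measure.map_infinitePi_infinitePi_of_inj
      (P := fun v : (Finset.univ ×ˢ Finset.range N : Finset (Fin d × ℕ)) => μ v.1.1) he
    rw [Measure.infinitePi_eq_pi, Measure.infinitePi_eq_pi, ← map_obs_refLaw μ,
      Measure.map_map (by fun_prop) (by fun_prop)] at h1
    exact h1
  have hms : MeasurableSet {w | b (ext w) ≠ 0} :=
    (hbm.comp hext) (measurableSet_singleton 0).compl
  have hzero : (Measure.pi fun v : F => μ v.1.1.1) {w | b (ext w) ≠ 0} = 0 := by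
    rw [← hmap, Measure.map_apply (by fun_prop) hms]
    have := (lintegral_eq_zero_iff (hbm.comp (measurable_obs S))).1 hb_obs
    have h2 : (fun z (v : F) => z v.1.1.2 v.1.1.1) ⁻¹' {w | b (ext w) ≠ 0}
        = {z : ArraySeq 𝒳 | b (obs S z) ≠ 0} := by
      ext z
      exact not_congr (iff_of_eq (congrArg (· = 0) (hbext (obs S z))))
    rw [h2]
    exact this
  have hρ0 := hρμ F hzero
  rw [Measure.map_apply (by fun_prop) hms] at hρ0
  have h3 : ∀ᵐ x ∂ρ, b (ext fun v => x v.1) = 0 := by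
    rw [ae_iff]; exact hρ0
  filter_upwards [h3] with x hx
  rw [hbext] at hx
  rw [ae_iff]
  simpa using hx

/-- The product over the positions of the base measures of `positionLaw` is obtained from `refLaw`
by overwriting the observables that are intervened on. -/
theorem map_fill_refLaw (M : ICMProcess.{u, w} μ) (S : Set (Fin d × ℕ)) (x : Values 𝒳 S) :
    (refLaw μ).map (fill S x) = Measure.infinitePi fun n => Measure.pi (M.base S x n) := by
  classical
  let f : ∀ (n : ℕ) (i : Fin d), 𝒳 i → 𝒳 i :=
    fun n i a => if h : (i, n) ∈ S then x ⟨(i, n), h⟩ else a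
  have hf : ∀ n i, Measurable (f n i) := by
    intro n i
    by_cases h : (i, n) ∈ S
    · simp only [f, h, dif_pos]; fun_prop
    · simp only [f, h, dif_neg, not_false_eq_true]; fun_prop
  have h1 := Measure.infinitePi_map_pi (fun _ : ℕ => Measure.pi μ)
    (f := fun n y i => f n i (y i)) (fun n => by
      exact measurable_pi_lambda _ fun i => (hf n i).comp (measurable_pi_apply i))
  refine h1.trans ?_
  congr 1
  funext n
  have hs : ∀ i, SigmaFinite ((μ i).map (f n i)) := fun i =>
    haveI := Measure.isProbabilityMeasure_map (μ := μ i) (hf n i).aemeasurable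
    inferInstance
  rw [Measure.pi_map_pi fun i => (hf n i).aemeasurable]
  congr 1
  funext i
  unfold ICMProcess.base
  by_cases h : (i, n) ∈ S
  · simp [f, h]
  · simp only [f, h, dif_neg, not_false_eq_true]
    exact Measure.map_id

end References

/-! ### Joint densities of observational and interventional laws -/

/-- A set of observables that contains with each observable its parents. -/
def ParentClosed {d : ℕ} (G : Digraph (Fin d)) (E : Set (Fin d × ℕ)) : Prop :=
  ∀ v ∈ E, ∀ j, G.Adj j v.1 → (j, v.2) ∈ E

namespace ICMProcess

variable {d : ℕ} {𝒳 : Fin d → Type u} [∀ i, MeasurableSpace (𝒳 i)] {μ : ∀ i, Measure (𝒳 i)}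

/-- The conditional density of the observable `v` given its parents and the parameters `θ`. -/
noncomputable def obsDensity (M : ICMProcess.{u, w} μ) (θ : ∀ i, M.Θ i) (v : Fin d × ℕ)
    (z : ArraySeq 𝒳) : ℝ≥0∞ :=
  M.p v.1 (θ v.1) (fun j => z v.2 j.1) (z v.2 v.1)

/-- The product over `v ∈ E` of the conditional densities given the parents and the parameters,
averaged over the parameters. -/
noncomputable def mixDensity (M : ICMProcess.{u, w} μ) (E : Finset (Fin d × ℕ))
    (z : ArraySeq 𝒳) : ℝ≥0∞ :=
  ∫⁻ θ, ∏ v ∈ E, M.obsDensity θ v z ∂Measure.pi M.ν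

theorem measurable_obsDensity (M : ICMProcess.{u, w} μ) (v : Fin d × ℕ) :
    Measurable fun q : (∀ i, M.Θ i) × ArraySeq 𝒳 => M.obsDensity q.1 v q.2 := by
  have h : Measurable fun q : (∀ i, M.Θ i) × ArraySeq 𝒳 =>
      ((q.1 v.1, (fun j => q.2 v.2 j.1, q.2 v.2 v.1)) :
        M.Θ v.1 × (∀ j : {j // M.G.Adj j v.1}, 𝒳 j.1) × 𝒳 v.1) := by
    fun_prop
  exact (M.measurable_p v.1).comp h

theorem measurable_prod_obsDensity (M : ICMProcess.{u, w} μ) (E : Finset (Fin d × ℕ)) :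
    Measurable fun q : (∀ i, M.Θ i) × ArraySeq 𝒳 => ∏ v ∈ E, M.obsDensity q.1 v q.2 :=
  Finset.measurable_fun_prod _ fun v _ => M.measurable_obsDensity v

theorem measurable_mixDensity (M : ICMProcess.{u, w} μ) (E : Finset (Fin d × ℕ)) :
    Measurable (M.mixDensity E) :=
  (M.measurable_prod_obsDensity E).lintegral_prod_left'

theorem dependsOnObs_obsDensity (M : ICMProcess.{u, w} μ) (θ : ∀ i, M.Θ i) (v : Fin d × ℕ) :
    DependsOnObs (M.obsDensity θ v) ({v} ∪ {v' | v'.2 = v.2 ∧ M.G.Adj v'.1 v.1}) := by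
  intro y z h
  unfold obsDensity
  rw [h v (.inl rfl)]
  congr 1
  funext j
  exact h (j.1, v.2) (.inr ⟨rfl, j.2⟩)

theorem dependsOnObs_prod_obsDensity (M : ICMProcess.{u, w} μ) (θ : ∀ i, M.Θ i)
    {E : Finset (Fin d × ℕ)} {E' : Set (Fin d × ℕ)} (hE : (E : Set (Fin d × ℕ)) ⊆ E')
    (hpa : ∀ v ∈ E, ∀ j, M.G.Adj j v.1 → (j, v.2) ∈ E') :
    DependsOnObs (fun z => ∏ v ∈ E, M.obsDensity θ v z) E' := by
  intro y z h
  refine Finset.prod_congr rfl fun v hv => M.dependsOnObs_obsDensity θ v fun v' hv' => h v' ?_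
  rcases hv' with rfl | ⟨h1, h2⟩
  · exact hE hv
  · have := hpa v hv v'.1 h2
    rwa [← h1] at this

theorem dependsOnObs_mixDensity (M : ICMProcess.{u, w} μ)
    {E : Finset (Fin d × ℕ)} {E' : Set (Fin d × ℕ)} (hE : (E : Set (Fin d × ℕ)) ⊆ E')
    (hpa : ∀ v ∈ E, ∀ j, M.G.Adj j v.1 → (j, v.2) ∈ E') :
    DependsOnObs (M.mixDensity E) E' :=
  fun _ _ h => lintegral_congr fun θ => M.dependsOnObs_prod_obsDensity θ hE hpa h

/-- As the parameters of different variables are independent, the averaged density factorizes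
over the variables. -/
theorem mixDensity_eq_prod (M : ICMProcess.{u, w} μ) (E : Finset (Fin d × ℕ)) (z : ArraySeq 𝒳) :
    M.mixDensity E z = ∏ i, M.mixDensity (E.filter fun v => v.1 = i) z := by
  -- `g i` collects the factors of the `i`-th variable as a function of the `i`-th parameter alone.
  let g : ∀ i, M.Θ i → ℝ≥0∞ := fun i t =>
    ∏ v ∈ E, if h : v.1 = i then M.p v.1 (h ▸ t) (fun j => z v.2 j.1) (z v.2 v.1) else 1
  have hg : ∀ i, Measurable (g i) := by
    intro i
    refine Finset.measurable_fun_prod _ fun v _ => ?_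
    by_cases h : v.1 = i
    · subst h
      simp only [dif_pos]
      have h : Measurable fun t : M.Θ v.1 => ((t, (fun j => z v.2 j.1, z v.2 v.1)) :
          M.Θ v.1 × (∀ j : {j // M.G.Adj j v.1}, 𝒳 j.1) × 𝒳 v.1) :=
        measurable_id.prodMk measurable_const
      exact (M.measurable_p v.1).comp h
    · simp only [h, dif_neg, not_false_eq_true]
      exact measurable_const
  have hgi : ∀ θ : ∀ i, M.Θ i, ∀ i,
      ∏ v ∈ E.filter (fun v => v.1 = i), M.obsDensity θ v z = g i (θ i) := by
    intro θ i
    rw [Finset.prod_filter]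
    refine Finset.prod_congr rfl fun v _ => ?_
    split_ifs with h
    · subst h; rfl
    · rfl
  have h1 : ∀ i, M.mixDensity (E.filter fun v => v.1 = i) z = ∫⁻ t, g i t ∂M.ν i := by
    intro i
    unfold mixDensity
    simp only [hgi]
    rw [← (measurePreserving_eval M.ν i).map_eq, lintegral_map (hg i) (measurable_pi_apply i)]
  simp only [h1]
  rw [← lintegral_infinitePi_finset_prod M.ν Finset.univ hg, Measure.infinitePi_eq_pi]
  refine lintegral_congr fun θ => ?_
  rw [← Finset.prod_fiberwise E (fun v => v.1)]
  exact Finset.prod_congr rfl fun i _ => hgi θ i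

theorem mixDensity_empty (M : ICMProcess.{u, w} μ) (z : ArraySeq 𝒳) : M.mixDensity ∅ z = 1 := by
  simp [mixDensity]

/-- The averaged density splits into the part of the `i`-th variable and that of all others. -/
theorem mixDensity_split (M : ICMProcess.{u, w} μ) (E : Finset (Fin d × ℕ)) (i : Fin d)
    (z : ArraySeq 𝒳) :
    M.mixDensity E z = M.mixDensity (E.filter fun v => v.1 = i) z
      * M.mixDensity (E.filter fun v => v.1 ≠ i) z := by
  rw [M.mixDensity_eq_prod E, M.mixDensity_eq_prod (E.filter fun v => v.1 ≠ i),
    ← Finset.mul_prod_erase _ _ (Finset.mem_univ i),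
    ← Finset.mul_prod_erase Finset.univ
      (fun j => M.mixDensity ((E.filter fun v => v.1 ≠ i).filter fun v => v.1 = j) z)
      (Finset.mem_univ i)]
  have h1 : (E.filter fun v => v.1 ≠ i).filter (fun v => v.1 = i) = ∅ := by
    ext v; simp
  rw [h1, mixDensity_empty, one_mul]
  congr 1
  refine Finset.prod_congr rfl fun j hj => ?_
  congr 1
  ext v
  simp only [Finset.mem_filter]
  have := Finset.ne_of_mem_erase hj
  grind

variable [∀ i, IsProbabilityMeasure (μ i)]

theorem lintegral_mul_mixDensity (M : ICMProcess.{u, w} μ) (E : Finset (Fin d × ℕ))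
    {F : ArraySeq 𝒳 → ℝ≥0∞} (hF : Measurable F) {f : ArraySeq 𝒳 → ArraySeq 𝒳}
    (hf : Measurable f) :
    ∫⁻ θ, ∫⁻ y, F (f y) * ∏ v ∈ E, M.obsDensity θ v (f y) ∂refLaw μ ∂Measure.pi M.ν
      = ∫⁻ y, F (f y) * M.mixDensity E (f y) ∂refLaw μ := by
  have hm : Measurable fun q : (∀ i, M.Θ i) × ArraySeq 𝒳 =>
      F (f q.2) * ∏ v ∈ E, M.obsDensity q.1 v (f q.2) := by
    have h1 := (M.measurable_prod_obsDensity E).comp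
      (measurable_fst.prodMk (hf.comp measurable_snd))
    exact (hF.comp (hf.comp measurable_snd)).mul h1
  rw [lintegral_lintegral_swap hm.aemeasurable]
  refine lintegral_congr fun y => ?_
  rw [lintegral_const_mul]
  · rfl
  · exact (M.measurable_prod_obsDensity E).comp measurable_prodMk_right

open Classical in
/-- Given the parameters, the observables outside of `S` at the first `N` positions have the product
of their conditional densities as joint density under `do(X_S = x)`. -/
theorem lintegral_infinitePi_positionLaw (M : ICMProcess.{u, w} μ) (S : Set (Fin d × ℕ))
    (x : Values 𝒳 S) (θ : ∀ i, M.Θ i) (N : ℕ) {F : ArraySeq 𝒳 → ℝ≥0∞} (hF : Measurable F)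
    (hFN : DependsOnObs F {v | v.2 < N}) :
    ∫⁻ z, F z ∂Measure.infinitePi (M.positionLaw S x θ)
      = ∫⁻ y, F (fill S x y) * ∏ v ∈ (Finset.univ ×ˢ Finset.range N).filter (· ∉ S),
          M.obsDensity θ v (fill S x y) ∂refLaw μ := by
  have hbase : ∀ n i, IsProbabilityMeasure (M.base S x n i) := by
    intro n i
    unfold base
    split_ifs <;> infer_instance
  have hfac : ∀ n, Measurable fun y => ∏ i, M.factor S n θ i y := fun n =>
    Finset.measurable_fun_prod _ fun i _ =>
      (M.measurable_factor S n i).comp (measurable_const.prodMk measurable_id)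
  have hdep : DependsOn F (Finset.range N : Set ℕ) := by
    intro y z h
    refine hFN fun v hv => ?_
    rw [h v.2 (by simpa using hv)]
  have hmeas : Measurable fun z : ArraySeq 𝒳 => F z * ∏ n ∈ Finset.range N,
      ∏ i, M.factor S n θ i (z n) :=
    hF.mul (Finset.measurable_fun_prod _ fun n _ => (hfac n).comp (measurable_pi_apply n))
  have hfill : Measurable (fill S x : ArraySeq 𝒳 → ArraySeq 𝒳) :=
    (measurable_fill S).comp measurable_prodMk_left
  rw [lintegral_infinitePi_withDensity (fun n => Measure.pi (M.base S x n)) (M.positionLaw S x θ)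
    (Finset.range N) hfac (fun n => rfl) hF hdep, ← map_fill_refLaw μ M S x,
    lintegral_map hmeas hfill]
  refine lintegral_congr fun y => ?_
  congr 1
  rw [Finset.prod_filter, Finset.prod_product_right]
  refine Finset.prod_congr rfl fun n _ => Finset.prod_congr rfl fun i _ => ?_
  by_cases h : (i, n) ∈ S
  · simp [factor, h]
  · simp [factor, h, obsDensity]

open Classical in
/-- Under `do(X_S = x)`, the observables outside of `S` at the first `N` positions have the
averaged product of their conditional densities as joint density. -/
theorem lintegral_doLaw (M : ICMProcess.{u, w} μ) (S : Set (Fin d × ℕ))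
    (x : Values 𝒳 S) (N : ℕ) {F : ArraySeq 𝒳 → ℝ≥0∞} (hF : Measurable F)
    (hFN : DependsOnObs F {v | v.2 < N}) :
    ∫⁻ z, F z ∂M.doLaw S x
      = ∫⁻ y, F (fill S x y) * M.mixDensity ((Finset.univ ×ˢ Finset.range N).filter (· ∉ S))
          (fill S x y) ∂refLaw μ := by
  rw [doLaw, Measure.lintegral_bind (M.measurable_infinitePi_positionLaw S x).aemeasurable
    hF.aemeasurable]
  simp only [M.lintegral_infinitePi_positionLaw S x _ N hF hFN]
  exact M.lintegral_mul_mixDensity _ hF ((measurable_fill S).comp measurable_prodMk_left)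

/-- The conditional density of an observable integrates to one against functions of the others. -/
theorem lintegral_refLaw_mul_obsDensity (M : ICMProcess.{u, w} μ) (θ : ∀ i, M.Θ i)
    {v : Fin d × ℕ} {F : ArraySeq 𝒳 → ℝ≥0∞} (hF : Measurable F) (hFv : DependsOnObs F {v}ᶜ) :
    ∫⁻ z, F z * M.obsDensity θ v z ∂refLaw μ = ∫⁻ z, F z ∂refLaw μ := by
  have hp : Measurable fun z => M.obsDensity θ v z :=
    (M.measurable_obsDensity v).comp measurable_prodMk_left
  have hFp : Measurable fun z => F z * M.obsDensity θ v z := hF.mul hp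
  rw [← lintegral_refLaw_splice μ {v} hFp]
  refine lintegral_congr fun y => ?_
  have h1 : ∀ z, F (splice {v} z y) = F y := fun z =>
    hFv.apply_splice_of_disjoint disjoint_compl_left z y
  have h2 : ∀ z, M.obsDensity θ v (splice {v} z y)
      = M.p v.1 (θ v.1) (fun j => y v.2 j.1) (z v.2 v.1) := by
    intro z
    unfold obsDensity
    rw [splice_of_mem z y (show (v.1, v.2) ∈ ({v} : Set (Fin d × ℕ)) from rfl)]
    congr 1
    funext j
    refine splice_of_notMem z y fun h => M.acyclic v.1 (.single ?_)
    have : j.1 = v.1 := congrArg Prod.fst h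
    simpa [this] using j.2
  have hpm : Measurable fun a => M.p v.1 (θ v.1) (fun j => y v.2 j.1) a :=
    (M.measurable_p v.1).comp (measurable_const.prodMk (measurable_const.prodMk measurable_id))
  have hev : Measurable fun z : ArraySeq 𝒳 => z v.2 v.1 :=
    (measurable_pi_apply v.1).comp (measurable_pi_apply v.2)
  have hpe : Measurable fun z : ArraySeq 𝒳 =>
      M.p v.1 (θ v.1) (fun j => y v.2 j.1) (z v.2 v.1) := hpm.comp hev
  simp only [h1, h2]
  rw [lintegral_const_mul _ hpe, ← lintegral_map hpm hev, map_eval_refLaw,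
    M.lintegral_p, mul_one]

/-- Observables outside of a parent-closed set `E` integrate out of the joint density. -/
theorem lintegral_refLaw_mul_prod_obsDensity (M : ICMProcess.{u, w} μ) (θ : ∀ i, M.Θ i)
    {E : Finset (Fin d × ℕ)} (hE : ParentClosed M.G (E : Set (Fin d × ℕ)))
    {F : ArraySeq 𝒳 → ℝ≥0∞} (hF : Measurable F) (hFE : DependsOnObs F E) (k : ℕ) :
    ∀ E' : Finset (Fin d × ℕ), E ⊆ E' → ParentClosed M.G (E' : Set (Fin d × ℕ)) →
      (E' \ E).card = k →
      ∫⁻ z, F z * ∏ v ∈ E', M.obsDensity θ v z ∂refLaw μ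
        = ∫⁻ z, F z * ∏ v ∈ E, M.obsDensity θ v z ∂refLaw μ := by
  classical
  induction k with
  | zero =>
    intro E' hEE' _ hk
    rw [Finset.card_eq_zero, Finset.sdiff_eq_empty_iff_subset] at hk
    rw [Finset.Subset.antisymm hEE' hk]
  | succ k ih =>
    intro E' hEE' hE' hk
    have : Std.Irrefl (Relation.TransGen (Function.swap M.G.Adj)) :=
      ⟨fun i h => M.acyclic i (Relation.transGen_swap.mp h)⟩
    have wf := Finite.wellFounded_of_trans_of_irrefl
      (Relation.TransGen (Function.swap M.G.Adj))
    -- Some `v` in `E' \ E` has no child in `E'`, as children in `E` would force `v` into `E`.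
    obtain ⟨v, hv, hmin⟩ := (InvImage.wf (Prod.fst : Fin d × ℕ → Fin d) wf).has_min
      ((E' \ E : Finset (Fin d × ℕ)) : Set (Fin d × ℕ))
      (Finset.coe_nonempty.mpr (Finset.card_pos.mp (by omega)))
    have hvE' : v ∈ E' := (Finset.mem_sdiff.1 hv).1
    have hvE : v ∉ E := (Finset.mem_sdiff.1 hv).2
    have hsink : ∀ v' ∈ E', v'.2 = v.2 → ¬ M.G.Adj v.1 v'.1 := by
      intro v' hv' h2 hadj
      by_cases hv'E : v' ∈ E
      · have := hE v' hv'E v.1 hadj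
        rw [h2] at this
        exact hvE this
      · exact hmin v' (Finset.mem_sdiff.2 ⟨hv', hv'E⟩) (.single hadj)
    have hsub : E ⊆ E'.erase v := fun v' hv' =>
      Finset.mem_erase.2 ⟨fun h => hvE (h ▸ hv'), hEE' hv'⟩
    have hclosed : ParentClosed M.G ((E'.erase v : Finset (Fin d × ℕ)) : Set (Fin d × ℕ)) := by
      intro v' hv' j hj
      have hv'' := Finset.mem_of_mem_erase hv'
      refine Finset.mem_erase.2 ⟨fun h => hsink v' hv'' ?_ ?_, hE' v' hv'' j hj⟩
      · rw [← h]
      · rwa [← h]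
    have hcard : (E'.erase v \ E).card = k := by
      rw [Finset.erase_sdiff_comm, Finset.card_erase_of_mem hv, hk]; rfl
    rw [← ih (E'.erase v) hsub hclosed hcard]
    have hdep : DependsOnObs (fun z => F z * ∏ v ∈ E'.erase v, M.obsDensity θ v z) {v}ᶜ := by
      refine (hFE.mono fun v' hv' => ?_).mul
        (M.dependsOnObs_prod_obsDensity θ (fun v' hv' => ?_) fun v' hv' j hj => ?_)
      · exact fun h => hvE ((Set.mem_singleton_iff.1 h) ▸ hv')
      · exact (Finset.mem_erase.1 hv').1
      · exact (Finset.mem_erase.1 (hclosed v' hv' j hj)).1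
    have hmeas : Measurable fun z => F z * ∏ v ∈ E'.erase v, M.obsDensity θ v z :=
      hF.mul ((M.measurable_prod_obsDensity _).comp measurable_prodMk_left)
    rw [← M.lintegral_refLaw_mul_obsDensity θ hmeas hdep]
    refine lintegral_congr fun z => ?_
    rw [← Finset.mul_prod_erase E' _ hvE']
    ring

/-- Under the observational law, the observables in a finite parent-closed set `E` have the
averaged product of their conditional densities as joint density. -/
theorem lintegral_law (M : ICMProcess.{u, w} μ) {E : Finset (Fin d × ℕ)}
    (hE : ParentClosed M.G (E : Set (Fin d × ℕ)))
    {F : ArraySeq 𝒳 → ℝ≥0∞} (hF : Measurable F) (hFE : DependsOnObs F E) :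
    ∫⁻ z, F z ∂M.law = ∫⁻ z, F z * M.mixDensity E z ∂refLaw μ := by
  classical
  obtain ⟨N, hN⟩ : ∃ N, ∀ v ∈ E, v.2 < N :=
    ⟨E.sup Prod.snd + 1, fun v hv => Nat.lt_succ_of_le (Finset.le_sup (f := Prod.snd) hv)⟩
  have hfill : ∀ y : ArraySeq 𝒳, fill ∅ (fun v => v.2.elim) y = y := fun y => by
    funext n i
    exact fill_of_notMem _ _ (Set.notMem_empty _)
  have hfilt : (Finset.univ ×ˢ Finset.range N).filter (· ∉ (∅ : Set (Fin d × ℕ)))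
      = Finset.univ ×ˢ Finset.range N := by simp
  rw [law, doLaw, Measure.lintegral_bind (M.measurable_infinitePi_positionLaw _ _).aemeasurable
    hF.aemeasurable]
  simp only [M.lintegral_infinitePi_positionLaw _ _ _ N hF (hFE.mono hN), hfill]
  refine Eq.trans ?_ (M.lintegral_mul_mixDensity E hF measurable_id)
  refine lintegral_congr fun θ => ?_
  refine M.lintegral_refLaw_mul_prod_obsDensity θ hE hF hFE _ _ (fun v hv => ?_) ?_ rfl
  · simpa using hN v hv
  · intro v hv j _
    simpa using hv

end ICMProcess

/-! ### Redrawing one variable -/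

namespace ICMProcess

theorem mem_parents {d : ℕ} {𝒳 : Fin d → Type u} [∀ i, MeasurableSpace (𝒳 i)]
    {μ : ∀ i, Measure (𝒳 i)} (M : ICMProcess.{u, w} μ) {i : Fin d} {N : ℕ} {v : Fin d × ℕ} :
    v ∈ M.parents i N ↔ M.G.Adj v.1 i ∧ v.2 < N := by
  rw [parents, Finset.mem_product]
  simp

variable {d : ℕ} {𝒳 : Fin d → Type u} [∀ i, MeasurableSpace (𝒳 i)] {μ : ∀ i, Measure (𝒳 i)}

/-- The integral of `F` over the observables in `{i} × A`, against their averaged density at the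
values that `z` gives to the parents; all other observables are kept as in `z`. -/
noncomputable def resample (M : ICMProcess.{u, w} μ) (i : Fin d) (A : Finset ℕ)
    (F : ArraySeq 𝒳 → ℝ≥0∞) (z : ArraySeq 𝒳) : ℝ≥0∞ :=
  ∫⁻ z', F (splice (({i} ×ˢ A : Finset (Fin d × ℕ)) : Set (Fin d × ℕ)) z' z)
    * M.mixDensity ({i} ×ˢ A)
      (splice (({i} ×ˢ A : Finset (Fin d × ℕ)) : Set (Fin d × ℕ)) z' z) ∂refLaw μ

theorem dependsOnObs_resample (M : ICMProcess.{u, w} μ) (i : Fin d) (A : Finset ℕ)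
    {F : ArraySeq 𝒳 → ℝ≥0∞} {E : Set (Fin d × ℕ)}
    (hF : DependsOnObs F (↑({i} ×ˢ A : Finset (Fin d × ℕ)) ∪ E))
    (hpa : ∀ n ∈ A, ∀ j, M.G.Adj j i → (j, n) ∈ E) :
    DependsOnObs (M.resample i A F) E := by
  have hK : DependsOnObs (M.mixDensity ({i} ×ˢ A))
      (↑({i} ×ˢ A : Finset (Fin d × ℕ)) ∪ E) := by
    refine M.dependsOnObs_mixDensity Set.subset_union_left fun v hv j hj => .inr ?_
    simp only [Finset.mem_product, Finset.mem_singleton] at hv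
    rw [hv.1] at hj
    exact hpa _ hv.2 j hj
  intro y z hyz
  refine lintegral_congr fun z' => hF.mul hK fun v hv => ?_
  by_cases hvI : v ∈ (({i} ×ˢ A : Finset (Fin d × ℕ)) : Set (Fin d × ℕ))
  · rw [splice_of_mem _ _ hvI, splice_of_mem _ _ hvI]
  · rw [splice_of_notMem _ _ hvI, splice_of_notMem _ _ hvI]
    exact hyz v (hv.resolve_left hvI)

variable [∀ i, IsProbabilityMeasure (μ i)]

theorem measurable_resample (M : ICMProcess.{u, w} μ) (i : Fin d) (A : Finset ℕ)
    {F : ArraySeq 𝒳 → ℝ≥0∞} (hF : Measurable F) : Measurable (M.resample i A F) := by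
  have h := measurable_splice (𝒳 := 𝒳)
    (({i} ×ˢ A : Finset (Fin d × ℕ)) : Set (Fin d × ℕ))
  have h2 : Measurable fun q : ArraySeq 𝒳 × ArraySeq 𝒳 =>
      F (splice (({i} ×ˢ A : Finset (Fin d × ℕ)) : Set (Fin d × ℕ)) q.1 q.2)
        * M.mixDensity ({i} ×ˢ A)
          (splice (({i} ×ˢ A : Finset (Fin d × ℕ)) : Set (Fin d × ℕ)) q.1 q.2) :=
    (hF.comp h).mul ((M.measurable_mixDensity _).comp h)
  exact h2.lintegral_prod_left'

/-- The joint law of `X_{i;A}` and the non-descendants of `i` at the first `N` positions is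
unchanged when `X_{i;A}` is drawn anew, given the other observables, from the averaged density of
the `i`-th variable, which involves the parents at the positions in `A` only. The reason is that the
averaged density of the non-descendants is a separate factor. -/
theorem lintegral_law_eq_resample (M : ICMProcess.{u, w} μ) (i : Fin d) (A : Finset ℕ) (N : ℕ)
    (hA : A ⊆ Finset.range N) {F : ArraySeq 𝒳 → ℝ≥0∞} (hF : Measurable F)
    (hFE : DependsOnObs F (↑({i} ×ˢ A : Finset (Fin d × ℕ)) ∪
      {v | v.2 < N ∧ v.1 ≠ i ∧ ¬ Relation.TransGen M.G.Adj i v.1})) :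
    ∫⁻ z, F z ∂M.law = ∫⁻ z, M.resample i A F z ∂M.law := by
  classical
  set I : Finset (Fin d × ℕ) := {i} ×ˢ A with hI
  let H : Finset (Fin d × ℕ) :=
    (Finset.univ.filter fun j => j ≠ i ∧ ¬ Relation.TransGen M.G.Adj i j) ×ˢ Finset.range N
  have hHset : (H : Set (Fin d × ℕ))
      = {v | v.2 < N ∧ v.1 ≠ i ∧ ¬ Relation.TransGen M.G.Adj i v.1} := by
    ext v
    simp [H, and_comm]
  have hmemI : ∀ v, v ∈ I ↔ v.1 = i ∧ v.2 ∈ A := fun v => by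
    rw [hI, Finset.mem_product, Finset.mem_singleton]
  have hmemH : ∀ v, v ∈ H ↔ v.2 < N ∧ v.1 ≠ i ∧ ¬ Relation.TransGen M.G.Adj i v.1 := by
    intro v
    simp [H, and_comm]
  have hHpa : ParentClosed M.G (H : Set (Fin d × ℕ)) := by
    intro v hv j hj
    obtain ⟨h1, h2, h3⟩ := (hmemH v).1 hv
    exact (hmemH _).2 ⟨h1, fun h => h3 (.single (h ▸ hj)), fun h => h3 (h.tail hj)⟩
  have hIpa : ∀ v ∈ I, ∀ j, M.G.Adj j v.1 → (j, v.2) ∈ H := by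
    intro v hv j hj
    obtain ⟨h1, h2⟩ := (hmemI v).1 hv
    rw [h1] at hj
    exact (hmemH _).2 ⟨Finset.mem_range.1 (hA h2),
      fun h => M.acyclic i (.single ((show j = i from h) ▸ hj)),
      fun h => M.acyclic i (h.tail hj)⟩
  have hEpa : ParentClosed M.G ((I ∪ H : Finset (Fin d × ℕ)) : Set (Fin d × ℕ)) := by
    intro v hv j hj
    rcases Finset.mem_union.1 hv with h | h
    · exact Finset.mem_union_right _ (hIpa v h j hj)
    · exact Finset.mem_union_right _ (hHpa v h j hj)
  have hdisj : Disjoint (H : Set (Fin d × ℕ)) I := by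
    rw [Finset.disjoint_coe, Finset.disjoint_left]
    exact fun v hv hv' => ((hmemH v).1 hv).2.1 ((hmemI v).1 hv').1
  have hfI : (I ∪ H).filter (fun v => v.1 = i) = I := by
    ext v
    simp only [Finset.mem_filter, Finset.mem_union, hmemI, hmemH]
    grind
  have hfH : (I ∪ H).filter (fun v => v.1 ≠ i) = H := by
    ext v
    simp only [Finset.mem_filter, Finset.mem_union, hmemI, hmemH]
    grind
  have hKH : DependsOnObs (M.mixDensity H) H :=
    M.dependsOnObs_mixDensity subset_rfl hHpa
  rw [← hHset] at hFE
  have hmeas : Measurable fun z => F z * M.mixDensity (I ∪ H) z :=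
    hF.mul (M.measurable_mixDensity _)
  rw [M.lintegral_law hEpa hF (by rwa [Finset.coe_union]),
    ← lintegral_refLaw_splice μ (I : Set (Fin d × ℕ)) hmeas,
    M.lintegral_law hHpa (M.measurable_resample i A hF)
      (M.dependsOnObs_resample i A hFE fun n hn j hj => hIpa (i, n) ((hmemI _).2 ⟨rfl, hn⟩) j hj)]
  refine lintegral_congr fun y => ?_
  have hm2 : Measurable fun z => F (splice (I : Set (Fin d × ℕ)) z y)
      * M.mixDensity I (splice (I : Set (Fin d × ℕ)) z y) :=
    (hF.mul (M.measurable_mixDensity I)).comp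
      ((measurable_splice _).comp measurable_prodMk_right)
  rw [resample, ← lintegral_mul_const _ hm2]
  refine lintegral_congr fun z => ?_
  rw [M.mixDensity_split (I ∪ H) i, hfI, hfH, hKH.apply_splice_of_disjoint hdisj, mul_assoc]

/-! ### Identification of the averaged conditional densities -/

/-- The observational law and the graph determine the averaged conditional densities almost
everywhere: redrawing `X_{i;A}` from the reference measures turns the observational law into a
measure with respect to which both densities have the same integrals, and positivity of the joint
density of the parents makes the reference measure absolutely continuous with respect to it. -/
theorem mixDensity_ae_eq (M : ICMProcess.{u, w} μ) (M' : ICMProcess.{u, w'} μ) (hG : M.G = M'.G)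
    (hlaw : M.law = M'.law) (hpos : M.ParentPositive) (i : Fin d) (A : Finset ℕ) :
    ∀ᵐ z ∂refLaw μ, M.mixDensity ({i} ×ˢ A) z = M'.mixDensity ({i} ×ˢ A) z := by
  classical
  obtain ⟨z₀⟩ := nonempty_of_isProbabilityMeasure (refLaw μ)
  obtain ⟨N, hN⟩ : ∃ N, A ⊆ Finset.range N :=
    ⟨A.sup id + 1, fun n hn =>
      Finset.mem_range.2 (Nat.lt_succ_of_le (Finset.le_sup (f := id) hn))⟩
  set I : Finset (Fin d × ℕ) := {i} ×ˢ A with hI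
  have hmemI : ∀ v, v ∈ I ↔ v.1 = i ∧ v.2 ∈ A := fun v => by
    rw [hI, Finset.mem_product, Finset.mem_singleton]
  set J : Set (Fin d × ℕ) := (I : Set (Fin d × ℕ)) ∪ M.parents i N with hJ
  have hK : DependsOnObs (M.mixDensity I) J := by
    refine M.dependsOnObs_mixDensity Set.subset_union_left fun v hv j hj => .inr ?_
    obtain ⟨h1, h2⟩ := (hmemI v).1 hv
    exact M.mem_parents.2 ⟨h1 ▸ hj, Finset.mem_range.1 (hN h2)⟩
  have hK' : DependsOnObs (M'.mixDensity I) J := by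
    refine M'.dependsOnObs_mixDensity Set.subset_union_left fun v hv j hj => .inr ?_
    obtain ⟨h1, h2⟩ := (hmemI v).1 hv
    exact M.mem_parents.2 ⟨by rw [hG]; exact h1 ▸ hj, Finset.mem_range.1 (hN h2)⟩
  have hsp : Measurable fun q : ArraySeq 𝒳 × ArraySeq 𝒳 => splice (I : Set (Fin d × ℕ)) q.2 q.1 :=
    (measurable_splice _).comp measurable_swap
  set T : Measure (ArraySeq 𝒳) :=
    (M.law.prod (refLaw μ)).map fun q => splice (I : Set (Fin d × ℕ)) q.2 q.1 with hT
  have key : ∀ {F : ArraySeq 𝒳 → ℝ≥0∞}, Measurable F → DependsOnObs F J →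
      ∫⁻ z, F z * M.mixDensity I z ∂T = ∫⁻ z, F z * M'.mixDensity I z ∂T := by
    intro F hF hFJ
    have hsub : J ⊆ (I : Set (Fin d × ℕ)) ∪
        {v | v.2 < N ∧ v.1 ≠ i ∧ ¬ Relation.TransGen M.G.Adj i v.1} := by
      rintro v (hv | hv)
      · exact .inl hv
      · obtain ⟨h1, h2⟩ := M.mem_parents.1 hv
        exact .inr ⟨h2, fun h => M.acyclic i (.single (by rwa [h] at h1)),
          fun h => M.acyclic i (h.tail h1)⟩
    have h1 := M.lintegral_law_eq_resample i A N hN hF (hFJ.mono hsub)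
    have h2 := M'.lintegral_law_eq_resample i A N hN hF (hFJ.mono (hG ▸ hsub))
    rw [← hlaw, h1] at h2
    have h3 : ∀ {K : ArraySeq 𝒳 → ℝ≥0∞}, Measurable K →
        ∫⁻ z, F z * K z ∂T = ∫⁻ z, ∫⁻ z', F (splice (I : Set (Fin d × ℕ)) z' z)
          * K (splice (I : Set (Fin d × ℕ)) z' z) ∂refLaw μ ∂M.law := by
      intro K hKm
      have hm : Measurable fun z => F z * K z := hF.mul hKm
      rw [hT, lintegral_map hm hsp]
      exact lintegral_prod _ (hm.comp hsp).aemeasurable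
    rw [h3 (M.measurable_mixDensity I), h3 (M'.measurable_mixDensity I)]
    exact h2
  -- Both densities have the same integrals, so they agree `T`-almost everywhere.
  have hTae : ∀ᵐ z ∂T, M.mixDensity I z = M'.mixDensity I z := by
    have hfill : Measurable fun x : Values 𝒳 J => fill J x z₀ :=
      (measurable_fill J).comp measurable_prodMk_right
    have hobs := measurable_obs (𝒳 := 𝒳) J
    have hTp : IsProbabilityMeasure T := Measure.isProbabilityMeasure_map hsp.aemeasurable
    have hTp' : IsProbabilityMeasure (T.map (obs J)) :=
      Measure.isProbabilityMeasure_map hobs.aemeasurable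
    have hae : (fun x => M.mixDensity I (fill J x z₀)) =ᵐ[T.map (obs J)]
        fun x => M'.mixDensity I (fill J x z₀) := by
      refine ae_eq_of_forall_setLIntegral_eq_of_sigmaFinite
        ((M.measurable_mixDensity I).comp hfill) ((M'.measurable_mixDensity I).comp hfill)
        fun s hs _ => ?_
      have hind : ∀ {K : ArraySeq 𝒳 → ℝ≥0∞}, Measurable K → DependsOnObs K J →
          ∫⁻ x in s, K (fill J x z₀) ∂T.map (obs J)
            = ∫⁻ z, (obs J ⁻¹' s).indicator 1 z * K z ∂T := by
        intro K hKm hKJ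
        have hKf : Measurable fun x : Values 𝒳 J => K (fill J x z₀) := hKm.comp hfill
        rw [setLIntegral_map hs hKf hobs, ← lintegral_indicator (hobs hs)]
        refine lintegral_congr fun z => ?_
        by_cases hz : z ∈ obs J ⁻¹' s
        · simp [hz, hKJ.apply_fill_obs]
        · simp [hz]
      rw [hind (M.measurable_mixDensity I) hK, hind (M'.measurable_mixDensity I) hK']
      exact key (measurable_one.indicator (hobs hs)) (dependsOnObs_preimage_obs s).indicator
    have := ae_of_ae_map hobs.aemeasurable hae
    filter_upwards [this] with z hz
    rwa [hK.apply_fill_obs, hK'.apply_fill_obs] at hz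
  -- It remains to pass from `T` to `refLaw`. Given the parents, the two measures treat `X_{i;A}` in
  -- the same way, so `b`, the mass of disagreement given the parents, is what has to be controlled.
  set B : Set (ArraySeq 𝒳) := {z | M.mixDensity I z ≠ M'.mixDensity I z} with hB
  have hBm : MeasurableSet B :=
    (measurableSet_eq_fun (M.measurable_mixDensity I) (M'.measurable_mixDensity I)).compl
  have hBJ : DependsOnObs (· ∈ B) J := fun y z hyz => by
    simp only [hB, Set.mem_ofPred_eq, hK hyz, hK' hyz]
  set b : ArraySeq 𝒳 → ℝ≥0∞ := fun z => refLaw μ {z' | splice (I : Set (Fin d × ℕ)) z' z ∈ B}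
    with hb
  have hbm : Measurable b := measurable_measure_prodMk_left (hsp hBm)
  have hbpa : DependsOnObs b (M.parents i N) := by
    intro y z hyz
    simp only [hb]
    congr 1
    ext z'
    refine iff_of_eq (hBJ fun v hv => ?_)
    by_cases hvI : v ∈ (I : Set (Fin d × ℕ))
    · rw [splice_of_mem _ _ hvI, splice_of_mem _ _ hvI]
    · rw [splice_of_notMem _ _ hvI, splice_of_notMem _ _ hvI]
      exact hyz v (hv.resolve_left hvI)
  have hb0 : M.law {z | b z ≠ 0} = 0 := by
    have h1 := ae_of_ae_map hsp.aemeasurable hTae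
    have h2 := Measure.ae_ae_of_ae_prod h1
    refine measure_mono_null ?_ (ae_iff.1 h2)
    intro z hz hz'
    exact hz (ae_iff.1 hz')
  -- Positivity carries this over from the observational law to the reference measures.
  have hb0' : refLaw μ {z | b z ≠ 0} = 0 := by
    let ext : (∀ v : M.parents i N, 𝒳 v.1.1) → ArraySeq 𝒳 :=
      fun x => fill (M.parents i N : Set (Fin d × ℕ)) (fun v => x ⟨v.1, v.2⟩) z₀
    have hext : Measurable ext := by
      refine (measurable_fill _).comp (Measurable.prodMk ?_ measurable_const)
      exact measurable_pi_lambda _ fun v => measurable_pi_apply _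
    have hbext : ∀ z : ArraySeq 𝒳, b (ext fun v => z v.1.2 v.1.1) = b z :=
      fun z => hbpa.apply_fill_obs z z₀
    have hms : MeasurableSet {x | b (ext x) ≠ 0} :=
      (hbm.comp hext) (measurableSet_singleton 0).compl
    have hpre : (fun (z : ArraySeq 𝒳) (v : M.parents i N) => z v.1.2 v.1.1) ⁻¹'
        {x | b (ext x) ≠ 0} = {z | b z ≠ 0} := by
      ext z
      exact not_congr (iff_of_eq (congrArg (· = 0) (hbext z)))
    have h1 : (Measure.pi fun v : M.parents i N => μ v.1.1) {x | b (ext x) ≠ 0} = 0 := by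
      refine hpos i N ?_
      rw [Measure.map_apply (by fun_prop) hms, hpre, hb0]
    rwa [← map_obs_refLaw, Measure.map_apply (by fun_prop) hms, hpre] at h1
  rw [ae_iff]
  have h1 := lintegral_refLaw_splice μ (I : Set (Fin d × ℕ)) (measurable_one.indicator hBm)
  rw [lintegral_indicator_one hBm] at h1
  change refLaw μ B = 0
  rw [← h1]
  rw [lintegral_eq_zero_iff]
  · refine measure_mono_null ?_ hb0'
    intro z hz hz'
    refine hz ((lintegral_indicator_one ?_).trans hz')
    exact (hsp hBm : MeasurableSet _) |> measurable_prodMk_left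
  · exact ((measurable_one.indicator hBm).comp (measurable_splice _)).lintegral_prod_left'

end ICMProcess

/-! ### Conditional independences and the graph -/

/-- If an `m`-measurable function `φ` is the conditional probability of `s` given `m`, and remains
so in the presence of the event `t`, then `s` and `t` are conditionally independent given `m`. -/
theorem condExp_indicator_inter_ae_eq_mul {Ω : Type*} {m mΩ : MeasurableSpace Ω} (hm : m ≤ mΩ)
    {P : Measure Ω} [IsFiniteMeasure P] {s t : Set Ω} (hs : MeasurableSet s)
    (ht : MeasurableSet t) {φ : Ω → ℝ≥0∞} (hφ : Measurable[m] φ)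
    (h : ∀ u, MeasurableSet[m] u → P (u ∩ s) = ∫⁻ z in u, φ z ∂P)
    (ht' : ∀ u, MeasurableSet[m] u → P (u ∩ (s ∩ t)) = ∫⁻ z in u ∩ t, φ z ∂P) :
    P⟦s ∩ t | m⟧ =ᵐ[P] fun z => (P⟦s | m⟧) z * (P⟦t | m⟧) z := by
  have hφm : Measurable φ := hφ.mono hm le_rfl
  have hfin : ∫⁻ z, φ z ∂P ≠ ∞ := by
    have := h Set.univ .univ
    rw [setLIntegral_univ] at this
    rw [← this]
    exact measure_ne_top _ _
  have hlt : ∀ᵐ z ∂P, φ z < ∞ := ae_lt_top hφm hfin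
  set r : Ω → ℝ := fun z => (φ z).toReal with hr
  have hrm : Measurable[m] r := hφ.ennreal_toReal
  have hri : Integrable r P := integrable_toReal_of_lintegral_ne_top hφm.aemeasurable hfin
  have hset : ∀ u, MeasurableSet u → ∫ z in u, r z ∂P = (∫⁻ z in u, φ z ∂P).toReal := by
    intro u hu
    exact integral_toReal hφm.aemeasurable (ae_restrict_of_ae hlt)
  have h1 : r =ᵐ[P] P⟦s | m⟧ := by
    refine ae_eq_condExp_of_forall_setIntegral_eq hm
      ((integrable_const (1 : ℝ)).indicator hs) (fun _ _ _ => hri.integrableOn)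
      (fun u hu _ => ?_) hrm.stronglyMeasurable.aestronglyMeasurable
    rw [hset u (hm u hu), ← h u hu, setIntegral_indicator hs, setIntegral_const, smul_eq_mul,
      mul_one]
    rfl
  have hone : Integrable (t.indicator fun _ => (1 : ℝ)) P := (integrable_const (1 : ℝ)).indicator ht
  have hprod : r * (t.indicator fun _ => (1 : ℝ)) = t.indicator r := by
    ext z
    by_cases hz : z ∈ t <;> simp [hz]
  have hrt : Integrable (r * (t.indicator fun _ => (1 : ℝ))) P := by
    rw [hprod]
    exact hri.indicator ht
  have h2 : P[r * (t.indicator fun _ => (1 : ℝ)) | m] =ᵐ[P] P⟦s ∩ t | m⟧ := by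
    refine ae_eq_condExp_of_forall_setIntegral_eq hm
      ((integrable_const (1 : ℝ)).indicator (hs.inter ht))
      (fun _ _ _ => integrable_condExp.integrableOn)
      (fun u hu _ => ?_) stronglyMeasurable_condExp.aestronglyMeasurable
    rw [setIntegral_condExp hm hrt hu, hprod, setIntegral_indicator ht,
      hset _ ((hm u hu).inter ht), ← ht' u hu, setIntegral_indicator (hs.inter ht),
      setIntegral_const, smul_eq_mul, mul_one]
    rfl
  have h3 := condExp_mul_of_stronglyMeasurable_left hrm.stronglyMeasurable hrt hone
  filter_upwards [h1, h2, h3] with z hz1 hz2 hz3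
  rw [← hz2, hz3, ← hz1, Pi.mul_apply]

theorem CondIndepObs.congr {d : ℕ} {𝒳 : Fin d → Type u} [∀ i, MeasurableSpace (𝒳 i)]
    [∀ i, StandardBorelSpace (𝒳 i)] {P P' : Measure (ArraySeq 𝒳)} [IsFiniteMeasure P]
    [IsFiniteMeasure P'] (hP : P = P') {A B C : Set (Fin d × ℕ)} (h : CondIndepObs P A B C) :
    CondIndepObs P' A B C := by
  subst hP
  exact h

namespace ICMProcess

variable {d : ℕ} {𝒳 : Fin d → Type u} [∀ i, MeasurableSpace (𝒳 i)]
  [∀ i, StandardBorelSpace (𝒳 i)] {μ : ∀ i, Measure (𝒳 i)} [∀ i, IsProbabilityMeasure (μ i)]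

/-- A variable is independent of each non-descendant, at the same or at another position, given
its parents at its own position. -/
theorem condIndepObs_parents (M : ICMProcess.{u, w} μ) {i k : Fin d} (hki : k ≠ i)
    (hk : ¬ Relation.TransGen M.G.Adj i k) (n : ℕ) :
    CondIndepObs M.law (({(i, 0)} : Finset (Fin d × ℕ)) : Set (Fin d × ℕ))
      (({(k, n)} : Finset (Fin d × ℕ)) : Set (Fin d × ℕ))
      (M.parents i 1 : Set (Fin d × ℕ)) := by
  obtain ⟨z₀⟩ := nonempty_of_isProbabilityMeasure (refLaw μ)
  unfold CondIndepObs
  rw [condIndepFun_iff_condExp_inter_preimage_eq_mul (measurable_obs _) (measurable_obs _)]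
  intro s t hs ht
  set C : Set (Fin d × ℕ) := (M.parents i 1 : Set (Fin d × ℕ)) with hC
  set s' := obs (𝒳 := 𝒳) (({(i, 0)} : Finset (Fin d × ℕ)) : Set (Fin d × ℕ)) ⁻¹' s with hs'
  set t' := obs (𝒳 := 𝒳) (({(k, n)} : Finset (Fin d × ℕ)) : Set (Fin d × ℕ)) ⁻¹' t with ht'
  have hsm : MeasurableSet s' := measurable_obs _ hs
  have htm : MeasurableSet t' := measurable_obs _ ht
  have hind : ∀ {E : Set (Fin d × ℕ)} (a : Set (Values 𝒳 E)),
      DependsOnObs ((obs E ⁻¹' a).indicator (1 : ArraySeq 𝒳 → ℝ≥0∞)) E :=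
    fun a => (dependsOnObs_preimage_obs a).indicator
  have hmemC : ∀ v, v ∈ C ↔ M.G.Adj v.1 i ∧ v.2 = 0 := fun v => by
    rw [hC, Finset.mem_coe, mem_parents, Nat.lt_one_iff]
  set φ := M.resample i {0} (s'.indicator 1) with hφ
  have hI : (({i} ×ˢ {0} : Finset (Fin d × ℕ)) : Set (Fin d × ℕ))
      = (({(i, 0)} : Finset (Fin d × ℕ)) : Set (Fin d × ℕ)) := by simp
  have hφm : Measurable φ := M.measurable_resample i {0} (measurable_one.indicator hsm)
  have hφC : DependsOnObs φ C := by
    refine M.dependsOnObs_resample i {0} ((hind s).mono ?_) fun n hn j hj => ?_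
    · rw [← hI]; exact Set.subset_union_left
    · exact (hmemC _).2 ⟨hj, by simpa using hn⟩
  have hφC' : Measurable[MeasurableSpace.comap (obs (𝒳 := 𝒳) C) inferInstance] φ := by
    have h1 : φ = (fun x => φ (fill C x z₀)) ∘ obs C :=
      funext fun z => (hφC.apply_fill_obs z z₀).symm
    have h2 : Measurable fun x => φ (fill C x z₀) :=
      hφm.comp ((measurable_fill C).comp measurable_prodMk_right)
    rw [h1]
    exact h2.comp (comap_measurable _)
  -- The event `s'` may be replaced by `φ` in the presence of any event about non-descendants.
  have key : ∀ a : Set (ArraySeq 𝒳), MeasurableSet a →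
      DependsOnObs (a.indicator (1 : ArraySeq 𝒳 → ℝ≥0∞))
        {v | v.2 < n + 1 ∧ v.1 ≠ i ∧ ¬ Relation.TransGen M.G.Adj i v.1} →
      M.law (a ∩ s') = ∫⁻ z in a, φ z ∂M.law := by
    intro a ha haD
    have hF : Measurable fun z => s'.indicator (1 : ArraySeq 𝒳 → ℝ≥0∞) z
        * a.indicator (1 : ArraySeq 𝒳 → ℝ≥0∞) z :=
      (measurable_one.indicator hsm).mul (measurable_one.indicator ha)
    have h1 := M.lintegral_law_eq_resample i {0} (n + 1) (by simp) hF
      (((hind s).mono (by rw [← hI]; exact Set.subset_union_left)).mul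
        (haD.mono Set.subset_union_right))
    have h2 : ∀ z, s'.indicator (1 : ArraySeq 𝒳 → ℝ≥0∞) z * a.indicator (1 : ArraySeq 𝒳 → ℝ≥0∞) z
        = (a ∩ s').indicator 1 z := by
      intro z
      by_cases hz : z ∈ s' <;> by_cases hz' : z ∈ a <;> simp [hz, hz']
    rw [lintegral_congr h2, lintegral_indicator_one (ha.inter hsm)] at h1
    rw [h1, ← lintegral_indicator ha]
    refine lintegral_congr fun z => ?_
    have hdisj : Disjoint {v : Fin d × ℕ | v.2 < n + 1 ∧ v.1 ≠ i ∧
        ¬ Relation.TransGen M.G.Adj i v.1}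
        (({i} ×ˢ {0} : Finset (Fin d × ℕ)) : Set (Fin d × ℕ)) := by
      rw [hI, Set.disjoint_left]
      rintro v hv hv'
      simp only [Finset.coe_singleton, Set.mem_singleton_iff] at hv'
      exact hv.2.1 (congrArg Prod.fst hv')
    simp only [resample, haD.apply_splice_of_disjoint hdisj]
    by_cases hz : z ∈ a
    · simp [hz, hφ, resample]
    · simp [hz]
  have hCD : C ⊆ {v | v.2 < n + 1 ∧ v.1 ≠ i ∧ ¬ Relation.TransGen M.G.Adj i v.1} := by
    intro v hv
    obtain ⟨h1, h2⟩ := (hmemC v).1 hv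
    exact ⟨by rw [h2]; exact Nat.succ_pos n, fun h => M.acyclic i (.single (by rwa [h] at h1)),
      fun h => M.acyclic i (h.tail h1)⟩
  refine condExp_indicator_inter_ae_eq_mul (measurable_obs C).comap_le hsm htm hφC' ?_ ?_
  · rintro _ ⟨u, hu, rfl⟩
    exact key _ (measurable_obs C hu) ((hind u).mono hCD)
  · rintro _ ⟨u, hu, rfl⟩
    rw [Set.inter_comm s', ← Set.inter_assoc]
    have hkn : ∀ v ∈ (({(k, n)} : Finset (Fin d × ℕ)) : Set (Fin d × ℕ)),
        v.2 < n + 1 ∧ v.1 ≠ i ∧ ¬ Relation.TransGen M.G.Adj i v.1 := by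
      intro v hv
      obtain rfl : v = (k, n) := by simpa using hv
      exact ⟨Nat.lt_succ_self n, hki, hk⟩
    refine key _ ((measurable_obs C hu).inter htm) (DependsOnObs.indicator fun y z hyz => ?_)
    exact congrArg₂ And
      (dependsOnObs_preimage_obs u fun v hv => hyz v (hCD hv))
      (dependsOnObs_preimage_obs t fun v hv => hyz v (hkn v hv))

/-- An edge `i → j` of a graph to which the law is faithful is an edge of the graph of every
process with this law: otherwise a conditional independence of that process would separate
`X_{i;0}` from `X_{j;0}`, or block the path `X_{i;0} ↔ X_{i;1} → X_{j;1}` by observables at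
position `0`. -/
theorem adj_of_adj (M : ICMProcess.{u, w} μ) (M' : ICMProcess.{u, w'} μ)
    (hM : Faithful M.law (icmGraph M.G)) (hlaw : M.law = M'.law) {i j : Fin d}
    (hij : M.G.Adj i j) : M'.G.Adj i j := by
  have hne : i ≠ j := fun h => M.acyclic i (.single (by rwa [← h] at hij))
  have hmem : ∀ (k : Fin d) (v : Fin d × ℕ), v ∈ M'.parents k 1 ↔ M'.G.Adj v.1 k ∧ v.2 = 0 :=
    fun k v => by rw [mem_parents, Nat.lt_one_iff]
  have hself : ∀ k, ¬ M'.G.Adj k k := fun k h => M'.acyclic k (.single h)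
  by_contra hij'
  by_cases hji : Relation.TransGen M'.G.Adj j i
  · have hnd : ¬ Relation.TransGen M'.G.Adj i j := fun h => M'.acyclic i (h.trans hji)
    have hci := (M'.condIndepObs_parents hne.symm hnd 1).congr hlaw.symm
    refine hM {(i, 0)} {(j, 1)} (M'.parents i 1) ?_ ?_ ?_ hci (i, 0) (by simp) (j, 1) (by simp) ?_
    · simp
    · simp [hmem, hself]
    · simp [hmem]
    · refine ⟨2, fun t => if t = 0 then (i, 0) else if t = 1 then (i, 1) else (j, 1),
        fun t => t = 0, fun _ => true, rfl, rfl, ?_, ?_, ?_⟩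
      · intro a ha b hb hab
        simp only [Set.mem_Iic] at ha hb
        interval_cases a <;> interval_cases b <;> simp_all
      · intro t ht
        interval_cases t
        · simp [MixedGraph.HasEdge, icmGraph]
        · simpa [MixedGraph.HasEdge, icmGraph] using hij
      · intro t ht
        obtain rfl : t = 0 := by omega
        simp [hmem]
  · have hci := (M'.condIndepObs_parents hne hji 0).congr hlaw.symm
    refine hM {(j, 0)} {(i, 0)} (M'.parents j 1) ?_ ?_ ?_ hci (j, 0) (by simp) (i, 0) (by simp) ?_
    · simpa using hne.symm
    · simp [hmem, hself]
    · simp [hmem, hij']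
    · refine ⟨1, fun t => if t = 0 then (j, 0) else (i, 0), fun _ => true, fun _ => false,
        rfl, rfl, ?_, ?_, ?_⟩
      · intro a ha b hb hab
        simp only [Set.mem_Iic] at ha hb
        interval_cases a <;> interval_cases b <;> simp_all
      · intro t ht
        interval_cases t
        simpa [MixedGraph.HasEdge, icmGraph] using hij
      · intro t ht
        omega

/-- Unlike graphs over independent copies, which are determined up to Markov equivalence only,
the graph of an exchangeable process is determined by a law that is faithful to it. -/
theorem graph_eq_of_law_eq (M : ICMProcess.{u, w} μ) (M' : ICMProcess.{u, w'} μ)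
    (hM : Faithful M.law (icmGraph M.G)) (hM' : Faithful M'.law (icmGraph M'.G))
    (hlaw : M.law = M'.law) : M.G = M'.G := by
  ext i j
  exact ⟨M.adj_of_adj M' hM hlaw, M'.adj_of_adj M hM' hlaw.symm⟩

end ICMProcess

/-! ### Identification of interventional laws -/

namespace ICMProcess

variable {d : ℕ} {𝒳 : Fin d → Type u} [∀ i, MeasurableSpace (𝒳 i)]

section Probability

variable {μ : ∀ i, Measure (𝒳 i)} [∀ i, IsProbabilityMeasure (μ i)]

theorem mixDensity_ae_eq_of_finset (M : ICMProcess.{u, w} μ) (M' : ICMProcess.{u, w'} μ)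
    (hG : M.G = M'.G) (hlaw : M.law = M'.law) (hpos : M.ParentPositive)
    (E : Finset (Fin d × ℕ)) :
    ∀ᵐ z ∂refLaw μ, M.mixDensity E z = M'.mixDensity E z := by
  have h := fun i => M.mixDensity_ae_eq M' hG hlaw hpos i
    ((E.filter fun v => v.1 = i).image Prod.snd)
  have hE : ∀ i, E.filter (fun v => v.1 = i)
      = {i} ×ˢ (E.filter fun v => v.1 = i).image Prod.snd := by
    intro i
    ext ⟨j, n⟩
    simp only [Finset.mem_filter, Finset.mem_product, Finset.mem_singleton, Finset.mem_image]
    constructor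
    · rintro ⟨h1, h2⟩
      exact ⟨h2, (j, n), ⟨h1, h2⟩, rfl⟩
    · rintro ⟨rfl, ⟨j', n'⟩, ⟨h1, h2⟩, h3⟩
      obtain rfl : j' = j := h2
      obtain rfl : n' = n := h3
      exact ⟨h1, rfl⟩
  filter_upwards [ae_all_iff.2 h] with z hz
  rw [M.mixDensity_eq_prod, M'.mixDensity_eq_prod]
  refine Finset.prod_congr rfl fun i _ => ?_
  rw [hE i]
  exact hz i

/-- Processes with the same graph and the same law have the same laws under almost every
intervention, as the densities of these are built from the identified averaged densities. -/
theorem doLaw_ae_eq (M : ICMProcess.{u, w} μ) (M' : ICMProcess.{u, w'} μ)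
    (hG : M.G = M'.G) (hlaw : M.law = M'.law) (hpos : M.ParentPositive) (S : Set (Fin d × ℕ)) :
    AlmostEveryValue μ S fun x => M.doLaw S x = M'.doLaw S x := by
  classical
  intro ρ hρ hρμ
  have hN : ∀ N : ℕ, ∀ᵐ x ∂ρ, ∀ᵐ y ∂refLaw μ,
      M.mixDensity ((Finset.univ ×ˢ Finset.range N).filter (· ∉ S)) (fill S x y)
        = M'.mixDensity ((Finset.univ ×ˢ Finset.range N).filter (· ∉ S)) (fill S x y) := by
    intro N
    set E := ((Finset.univ : Finset (Fin d)) ×ˢ Finset.range N).filter (· ∉ S) with hE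
    have hEN : ∀ v ∈ E, v.2 < N := fun v hv => by
      simpa using (Finset.mem_product.1 (Finset.mem_filter.1 hv).1).2
    have hdep : DependsOnObs (M.mixDensity E) {v | v.2 < N} :=
      M.dependsOnObs_mixDensity hEN fun v hv j _ => hEN v hv
    have hdep' : DependsOnObs (M'.mixDensity E) {v | v.2 < N} :=
      M'.dependsOnObs_mixDensity hEN fun v hv j _ => hEN v hv
    have hB : MeasurableSet {z | M.mixDensity E z ≠ M'.mixDensity E z} :=
      (measurableSet_eq_fun (M.measurable_mixDensity E) (M'.measurable_mixDensity E)).compl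
    have h := ae_fill_of_ae_refLaw μ S (N := N) hB
      (fun y z hyz => by simp only [Set.mem_ofPred_eq, hdep hyz, hdep' hyz])
      (ae_iff.1 (M.mixDensity_ae_eq_of_finset M' hG hlaw hpos E)) ρ hρ hρμ
    filter_upwards [h] with x hx
    filter_upwards [hx] with y hy
    simpa using hy
  filter_upwards [ae_all_iff.2 hN] with x hx
  refine ext_of_generate_finite _ generateFrom_squareCylinders.symm
    (isPiSystem_squareCylinders (fun _ => MeasurableSpace.isPiSystem_measurableSet)
      fun _ => by simp) ?_ (by simp)
  rintro _ ⟨s, t, ht, rfl⟩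
  have hbox : MeasurableSet (Set.pi (s : Set ℕ) t) :=
    .pi s.countable_toSet fun n _ => ht n (Set.mem_univ n)
  obtain ⟨N, hsN⟩ : ∃ N, ∀ n ∈ s, n < N :=
    ⟨s.sup id + 1, fun n hn => Nat.lt_succ_of_le (Finset.le_sup (f := id) hn)⟩
  have hF : Measurable ((Set.pi (s : Set ℕ) t).indicator (1 : ArraySeq 𝒳 → ℝ≥0∞)) :=
    measurable_one.indicator hbox
  have hFN : DependsOnObs ((Set.pi (s : Set ℕ) t).indicator (1 : ArraySeq 𝒳 → ℝ≥0∞))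
      {v | v.2 < N} := by
    refine DependsOnObs.indicator fun y z hyz => propext ?_
    simp only [Set.mem_pi]
    refine forall₂_congr fun n hn => ?_
    rw [show y n = z n from funext fun i => hyz (i, n) (hsN n hn)]
  rw [← lintegral_indicator_one hbox, ← lintegral_indicator_one hbox,
    M.lintegral_doLaw S x N hF hFN, M'.lintegral_doLaw S x N hF hFN]
  refine lintegral_congr_ae ?_
  filter_upwards [hx N] with y hy
  rw [hy]

theorem effect_ae_eq_of_probability [∀ i, StandardBorelSpace (𝒳 i)]
    (M : ICMProcess.{u, w} μ) (M' : ICMProcess.{u, w'} μ)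
    (hM : Faithful M.law (icmGraph M.G)) (hM' : Faithful M'.law (icmGraph M'.G))
    (hpos : M.ParentPositive) (hlaw : M.law = M'.law) (X Y : Set (Fin d × ℕ)) :
    AlmostEveryValue μ X fun x => M.effect Y X x = M'.effect Y X x := by
  intro ρ hρ hρμ
  filter_upwards [M.doLaw_ae_eq M' (M.graph_eq_of_law_eq M' hM hM' hlaw) hlaw hpos X ρ hρ hρμ]
    with x hx
  rw [effect, effect, hx]

end Probability

/-! ### Change of reference measures -/

variable {μ : ∀ i, Measure (𝒳 i)}

/-- The same process with its densities taken with respect to other reference measures `π`, with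
respect to which the reference measures `μ` have densities `g`. -/
noncomputable def reweight (M : ICMProcess.{u, w} μ) (π : ∀ i, Measure (𝒳 i))
    (g : ∀ i, 𝒳 i → ℝ≥0∞) (hg : ∀ i, Measurable (g i))
    (hμ : ∀ i, μ i = (π i).withDensity (g i)) : ICMProcess.{u, w} π where
  G := M.G
  acyclic := M.acyclic
  Θ := M.Θ
  measurableSpaceΘ := M.measurableSpaceΘ
  ν := M.ν
  isProbabilityMeasure_ν := M.isProbabilityMeasure_ν
  p i θ pa x := g i x * M.p i θ pa x
  measurable_p i := by
    have h : Measurable fun z : M.Θ i × (∀ j : {j // M.G.Adj j i}, 𝒳 j.1) × 𝒳 i => g i z.2.2 :=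
      (hg i).comp (measurable_snd.comp measurable_snd)
    exact h.mul (M.measurable_p i)
  lintegral_p i θ pa := by
    have h : Measurable fun x => M.p i θ pa x :=
      (M.measurable_p i).comp (measurable_const.prodMk (measurable_const.prodMk measurable_id))
    rw [← M.lintegral_p i θ pa, hμ i, lintegral_withDensity_eq_lintegral_mul _ (hg i) h]
    rfl

section Reweight

variable [∀ i, SigmaFinite (μ i)] (M : ICMProcess.{u, w} μ) (π : ∀ i, Measure (𝒳 i))
  [∀ i, IsProbabilityMeasure (π i)] (g : ∀ i, 𝒳 i → ℝ≥0∞) (hg : ∀ i, Measurable (g i))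
  (hμ : ∀ i, μ i = (π i).withDensity (g i))

theorem positionLaw_reweight (S : Set (Fin d × ℕ)) (x : Values 𝒳 S) (θ : ∀ i, M.Θ i) (n : ℕ) :
    (M.reweight π g hg hμ).positionLaw S x θ n = M.positionLaw S x θ n := by
  classical
  set M₁ := M.reweight π g hg hμ with hM₁
  let h : ∀ i, 𝒳 i → ℝ≥0∞ := fun i => if (i, n) ∈ S then 1 else g i
  have hh : ∀ i, Measurable (h i) := by
    intro i
    by_cases hi : (i, n) ∈ S
    · simp only [h, hi, if_true]; exact measurable_one
    · simp only [h, hi, if_false]; exact hg i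
  have hprob : ∀ i, IsProbabilityMeasure (M₁.base S x n i) := by
    intro i
    unfold base
    split_ifs <;> infer_instance
  have hbase : ∀ i, M.base S x n i = (M₁.base S x n i).withDensity (h i) := by
    intro i
    by_cases hi : (i, n) ∈ S
    · simp [base, h, hi]
    · simp [base, h, hi, hμ i]
  have hfac : Measurable fun y => ∏ i, M.factor S n θ i y :=
    Finset.measurable_fun_prod _ fun i _ =>
      (M.measurable_factor S n i).comp (measurable_const.prodMk measurable_id)
  have hhm : Measurable fun y : ∀ i, 𝒳 i => ∏ i, h i (y i) :=
    Finset.measurable_fun_prod _ fun i _ => (hh i).comp (measurable_pi_apply i)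
  change (Measure.pi (M₁.base S x n)).withDensity (fun y => ∏ i, M₁.factor S n θ i y)
    = (Measure.pi (M.base S x n)).withDensity fun y => ∏ i, M.factor S n θ i y
  rw [pi_withDensity_of_probability _ _ hh hbase,
    ← withDensity_mul _ hhm hfac]
  congr 1
  ext y
  rw [Pi.mul_apply, ← Finset.prod_mul_distrib]
  refine Finset.prod_congr rfl fun i _ => ?_
  by_cases hi : (i, n) ∈ S
  · simp [factor, h, hi]
  · simp only [factor, h, hi, if_false]
    rfl

theorem doLaw_reweight (S : Set (Fin d × ℕ)) (x : Values 𝒳 S) :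
    (M.reweight π g hg hμ).doLaw S x = M.doLaw S x := by
  have h : (fun θ => Measure.infinitePi ((M.reweight π g hg hμ).positionLaw S x θ))
      = fun θ => Measure.infinitePi (M.positionLaw S x θ) := by
    funext θ
    congr 1
    funext n
    exact M.positionLaw_reweight π g hg hμ S x θ n
  exact congrArg (Measure.pi M.ν).bind h

end Reweight

end ICMProcess

theorem Faithful.congr {d : ℕ} {𝒳 : Fin d → Type u} [∀ i, MeasurableSpace (𝒳 i)]
    [∀ i, StandardBorelSpace (𝒳 i)] {P P' : Measure (ArraySeq 𝒳)} [IsFiniteMeasure P]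
    [IsFiniteMeasure P'] (hP : P = P') {H : MixedGraph (Fin d × ℕ)} (h : Faithful P H) :
    Faithful P' H := by
  subst hP
  exact h

/-- A finite product of probability measures is dominated by a product of measures that have
almost everywhere nonzero densities with respect to them. -/
theorem pi_absolutelyContinuous_of_withDensity {ι : Type*} [Fintype ι] {α : ι → Type*}
    [∀ i, MeasurableSpace (α i)] (m m' : ∀ i, Measure (α i)) [∀ i, IsProbabilityMeasure (m i)]
    [∀ i, SigmaFinite (m' i)] {h : ∀ i, α i → ℝ≥0∞}
    (hh : ∀ i, Measurable (h i)) (hs : ∀ i, m' i = (m i).withDensity (h i))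
    (hpos : ∀ i, ∀ᵐ a ∂m i, h i a ≠ 0) : Measure.pi m ≪ Measure.pi m' := by
  rw [pi_withDensity_of_probability m m' hh hs]
  refine withDensity_absolutelyContinuous' (Finset.measurable_fun_prod _ fun i _ =>
    (hh i).comp (measurable_pi_apply i)).aemeasurable ?_
  have := ae_all_iff.2 fun i => (measurePreserving_eval m i).quasiMeasurePreserving.ae (hpos i)
  filter_upwards [this] with x hx
  exact Finset.prod_ne_zero_iff.2 fun i _ => hx i

theorem theorem2 {d : ℕ} {𝒳 : Fin d → Type u} [∀ i, MeasurableSpace (𝒳 i)]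
    [∀ i, StandardBorelSpace (𝒳 i)] (μ : ∀ i, Measure (𝒳 i)) [∀ i, SigmaFinite (μ i)]
    (M : ICMProcess.{u, w} μ) (M' : ICMProcess.{u, w'} μ)
    (hM : Faithful M.law (icmGraph M.G)) (hM' : Faithful M'.law (icmGraph M'.G))
    (hpos : M.ParentPositive) (hpos' : M'.ParentPositive)
    (hlaw : M.law = M'.law)
    (X Y : Set (Fin d × ℕ)) (hXY : Disjoint X Y) :
    AlmostEveryValue μ X fun x => M.effect Y X x = M'.effect Y X x := by
  -- `toFinite` is a probability measure only for nonzero measures; the densities integrate to one.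
  have hμ0 : ∀ i, NeZero (μ i) := by
    intro i
    obtain ⟨θ⟩ := nonempty_of_isProbabilityMeasure (Measure.pi M.ν)
    have pa := fun j : {j // M.G.Adj j i} => (M.nonempty_obs θ j.1).some
    refine ⟨fun h => ?_⟩
    have := M.lintegral_p i (θ i) pa
    simp [h] at this
  -- Both processes are rewritten with densities with respect to probability measures `π i` that
  -- have the same null sets as the `μ i`.
  let π : ∀ i, Measure (𝒳 i) := fun i => (μ i).toFinite
  have hπ : ∀ i, IsProbabilityMeasure (π i) := fun i => by
    have := hμ0 i
    exact inferInstanceAs (IsProbabilityMeasure (μ i).toFinite)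
  let g : ∀ i, 𝒳 i → ℝ≥0∞ := fun i => (μ i).rnDeriv (π i)
  have hg : ∀ i, Measurable (g i) := fun i => Measure.measurable_rnDeriv _ _
  have hμ : ∀ i, μ i = (π i).withDensity (g i) := fun i =>
    (Measure.withDensity_rnDeriv_eq _ _ (absolutelyContinuous_toFinite (μ i))).symm
  have hg0 : ∀ i, ∀ᵐ a ∂π i, g i a ≠ 0 := by
    intro i
    have h := toFinite_absolutelyContinuous (μ i)
      |>.ae_le (Measure.rnDeriv_pos (absolutelyContinuous_toFinite (μ i)))
    filter_upwards [h] with a ha using ha.ne'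
  have hlawM : (M.reweight π g hg hμ).law = M.law := M.doLaw_reweight π g hg hμ _ _
  have hlawM' : (M'.reweight π g hg hμ).law = M'.law := M'.doLaw_reweight π g hg hμ _ _
  have hposM : (M.reweight π g hg hμ).ParentPositive := by
    intro i N
    rw [hlawM]
    refine (pi_absolutelyContinuous_of_withDensity _ _ (fun v => hg v.1.1) (fun v => hμ v.1.1)
      fun v => hg0 v.1.1).trans (hpos i N)
  have h := (M.reweight π g hg hμ).effect_ae_eq_of_probability (M'.reweight π g hg hμ)
    (hM.congr hlawM.symm) (hM'.congr hlawM'.symm) hposM (hlawM.trans (hlaw.trans hlawM'.symm)) X Y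
  intro ρ hρ hρμ
  have hρπ : ∀ F : Finset X,
      ρ.map (fun x (v : F) => x v.1) ≪ Measure.pi fun v : F => π v.1.1.1 := by
    intro F
    refine (hρμ F).trans ?_
    rw [pi_withDensity_of_probability (fun v : F => π v.1.1.1) (fun v : F => μ v.1.1.1)
      (fun v => hg v.1.1.1) fun v => hμ v.1.1.1]
    exact withDensity_absolutelyContinuous _ _
  filter_upwards [h ρ hρ hρπ] with x hx
  simpa only [ICMProcess.effect, ICMProcess.doLaw_reweight] using hx
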